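/- All graphs are finite and simple. For a field $K\in\{\mathbb{R},\mathbb{C}\}$, a realisation of a graph $G=(V,E)$ over $K$ is a map $p:V\to K^2$; it is generic if the $2|V|$ coordinates of the points $p(v)$, $v\in V$, are algebraically independent over $\mathbb{Q}$. Put $d(x,y)=x^2+y^2$. Two realisations $p,q$ of $G$ are equivalent if $d(p(u)-p(v))=d(q(u)-q(v))$ for all $uv\in E$, and congruent if this equality holds for all $u,v\in V$. A real realisation $p$ of $G$ is rigid if there is $\varepsilon>0$ such that every real realisation $q$ of $G$ which is equivalent to $p$ and satisfies $d(p(v)-q(v))<\varepsilon$ for all $v\in V$ is congruent to $p$. The graph $G$ is rigid if every (equivalently, some) generic real realisation of $G$ is rigid. For a complex realisation $p$ of $G$, let $c(G,p)$ be the number of congruence classes in the set of all complex realisations of $G$ equivalent to $p$. For a rigid graph $G$, this number is finite and has the same value for all generic complex realisations $p$ of $G$; the common value is denoted $c(G)$. A $2$-separation of $G$ is a pair $(G_1,G_2)$ of edge-disjoint subgraphs of $G$, each with at least three vertices, such that $G=G_1\cup G_2$ and $|V(G_1)\cap V(G_2)|=2$. **Lemma.** Let $(G_1,G_2)$ be a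 $2$-separation of a rigid graph $G$ with $V(G_1)\cap V(G_2)=\{v_1,v_2\}$. Suppose that $G_2$ is not rigid, and put $H_2=G_2+e$, where $e=v_1v_2$. Then $G_1$ and $H_2$ are both rigid, the numbers $c(G)$, $c(G_1)$ and $c(H_2)$ are therefore well defined and finite, and $$c(G)=2\,c(G_1)\,c(H_2).$$ -/

import Mathlib

namespace ComplexRigidity

/-- The quadratic form `d(x, y) = x² + y²` on `K²` (over `ℂ` it is not the Hermitian norm). -/
def sqLen {K : Type*} [CommRing K] (P : Fin 2 → K) : K := P 0 ^ 2 + P 1 ^ 2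

/-- A realisation of a graph on the vertex set `V` in the plane over `K`. -/
abbrev Realisation (V K : Type*) := V → Fin 2 → K

/-- A realisation is generic if the family of the `2|V|` coordinates of its points is
algebraically independent over `ℚ`. -/
def IsGeneric {V K : Type*} [Field K] [CharZero K] (p : Realisation V K) : Prop :=
  AlgebraicIndependent ℚ (fun i : V × Fin 2 => p i.1 i.2)

/-- `(G, p)` and `(G, q)` are equivalent: all edges have the same squared length. -/
def IsEquivalent {V K : Type*} [CommRing K] (G : SimpleGraph V) (p q : Realisation V K) : Prop :=
  ∀ u v : V, G.Adj u v → sqLen (p u - p v) = sqLen (q u - q v)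

/-- `(G, p)` and `(G, q)` are congruent: all pairs of vertices have the same squared distance. -/
def IsCongruent {V K : Type*} [CommRing K] (p q : Realisation V K) : Prop :=
  ∀ u v : V, sqLen (p u - p v) = sqLen (q u - q v)

/-- A real framework `(G, p)` is rigid if every equivalent real framework that is sufficiently
close to it is congruent to it. -/
def IsRigidFramework {V : Type*} (G : SimpleGraph V) (p : Realisation V ℝ) : Prop :=
  ∃ ε : ℝ, 0 < ε ∧ ∀ q : Realisation V ℝ,
    IsEquivalent G p q → (∀ v : V, sqLen (p v - q v) < ε) → IsCongruent p q

/-- A graph is rigid if every generic real realisation of it is rigid. -/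
def IsRigid {V : Type*} (G : SimpleGraph V) : Prop :=
  ∀ p : Realisation V ℝ, IsGeneric p → IsRigidFramework G p

/-- Congruence, on the set of all complex realisations of `G` that are equivalent to `(G, p)`. -/
def congruenceSetoid {V : Type*} (G : SimpleGraph V) (p : Realisation V ℂ) :
    Setoid {q : Realisation V ℂ // IsEquivalent G p q} where
  r q q' := IsCongruent q.1 q'.1
  iseqv :=
    { refl := fun _ _ _ => rfl
      symm := fun h u v => (h u v).symm
      trans := fun h h' u v => (h u v).trans (h' u v) }

/-- `c(G, p)`: the number (possibly `⊤`) of congruence classes in the set of all complex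
realisations of `G` that are equivalent to `(G, p)`. -/
noncomputable def numClasses {V : Type*} (G : SimpleGraph V) (p : Realisation V ℂ) : ℕ∞ :=
  ENat.card (Quotient (congruenceSetoid G p))

/-- `c(G)` exists and is equal to the natural number `k`: for every generic complex
realisation `p` of `G`, the number `c(G, p)` is finite and equal to `k`. -/
def IsRealisationNumber {V : Type*} (G : SimpleGraph V) (k : ℕ) : Prop :=
  ∀ p : Realisation V ℂ, IsGeneric p → numClasses G p = (k : ℕ∞)

/-- `(G₁, G₂)` is a `k`-separation of `G`. -/
structure IsSeparation {V : Type*} {G : SimpleGraph V} (k : ℕ) (G₁ G₂ : G.Subgraph) : Prop where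
  edge_disjoint : Disjoint G₁.edgeSet G₂.edgeSet
  card_left : k + 1 ≤ G₁.verts.ncard
  card_right : k + 1 ≤ G₂.verts.ncard
  union_eq : G₁ ⊔ G₂ = ⊤
  card_inter : (G₁.verts ∩ G₂.verts).ncard = k

end ComplexRigidity

/-! Rigidity is first made algebraic. By `isRigid_iff_isAlgRigid`, a graph is rigid iff every
squared distance, as a polynomial in the coordinates, is algebraic over the squared edge lengths. In
the algebraic matroid of `ℂ` over `ℚ` this becomes a rank condition: the edge lengths of a generic
realisation have rank at least `2|V| - 3` (`isAlgRigid_iff_le_eRk`).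

Write `Vᵢ` for the vertex set of `Gᵢ`, so `|V₁| + |V₂| = |V| + 2`. The rank that `G₂` lacks forces
full rank on `G₁`. Moreover, if `q` is a realisation of `G₁` equivalent to the restriction of `p`,
and `δ` is the squared distance of the separating pair in `q`, then `δ` raises the lengths of `G₂`
to full rank (`IsSeparation.le_eRk_insert`). For the restriction of `p` itself this says that `H₂`
is rigid. For every `q` it says that `δ` is transcendental over the lengths of `G₂`
(`IsSeparation.notMem_closure`).

Any two such `δ` are therefore conjugate under an automorphism of `ℂ` fixing the lengths of `G₂`. So
the number of realisations of `G₂` that can be glued to `q` does not depend on `q`, and it is the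
number for `H₂`. To make gluing unambiguous, realisations are counted in isotropic coordinates `z =
x + iy`, `w = x - iy`, where `d` becomes the product `zw`, normalised by `z = w = 0` at `v₁` and `z
= 1` at `v₂`. Each congruence class contains exactly two normalised realisations, exchanged by a
reflection (`card_normalSet`). Hence `2c(G) = 2c(G₁) · 2c(H₂)`. -/

namespace ComplexRigidity

/-! ### Automorphisms of algebraically closed fields -/

section Automorphisms

open Cardinal

/-- Two transcendence bases of an algebraically closed field with the same index set are
conjugate under an automorphism over the base ring. -/
theorem exists_algEquiv_of_isTranscendenceBasis {R K κ : Type*} [CommRing R] [Field K]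
    [Algebra R K] [IsAlgClosed K] {v w : κ → K} (hv : IsTranscendenceBasis R v)
    (hw : IsTranscendenceBasis R w) : ∃ σ : K ≃ₐ[R] K, ∀ i, σ (v i) = w i := by
  let := IsAlgClosed.isAlgClosure_of_transcendence_basis v hv
  let := IsAlgClosed.isAlgClosure_of_transcendence_basis w hw
  let e : Algebra.adjoin R (Set.range v) ≃ₐ[R] Algebra.adjoin R (Set.range w) :=
    hv.1.aevalEquiv.symm.trans hw.1.aevalEquiv
  -- `K` is an algebraic closure of both polynomial subalgebras, so the isomorphism between them
  -- extends to `K`.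
  let σ := IsAlgClosure.equivOfEquiv K K e.toRingEquiv
  have hσ (s : Algebra.adjoin R (Set.range v)) : σ (s : K) = (e s : K) :=
    IsAlgClosure.equivOfEquiv_algebraMap K K e.toRingEquiv s
  refine ⟨AlgEquiv.ofRingEquiv (f := σ) fun r ↦ ?_, fun i ↦ ?_⟩
  · have h := hσ (algebraMap R _ r)
    rw [e.commutes] at h
    exact h
  · have h1 : hv.1.aevalEquiv (MvPolynomial.X i) =
        ⟨v i, Algebra.subset_adjoin (Set.mem_range_self i)⟩ := Subtype.ext (by simp)
    have h := hσ ⟨v i, Algebra.subset_adjoin (Set.mem_range_self i)⟩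
    rw [← h1] at h
    simpa [e] using h

/-- Finite algebraically independent families over a countable ring in an uncountable
algebraically closed field are conjugate. -/
theorem exists_algEquiv_of_algebraicIndependent {R K ι : Type*} [CommRing R] [Countable R]
    [Field K] [Algebra R K] [IsAlgClosed K] [Finite ι] (hK : ℵ₀ < #K) {x y : ι → K}
    (hx : AlgebraicIndependent R x) (hy : AlgebraicIndependent R y) :
    ∃ σ : K ≃ₐ[R] K, ∀ i, σ (x i) = y i := by
  classical
  have := RingHom.domain_nontrivial (algebraMap R K)
  obtain ⟨s, hxs, hs⟩ := exists_isTranscendenceBasis_superset hx.to_subtype_range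
  obtain ⟨t, hyt, ht⟩ := exists_isTranscendenceBasis_superset hy.to_subtype_range
  have card (u : Set K) (hu : IsTranscendenceBasis R ((↑) : u → K)) : #u = #K := by
    have := IsAlgClosed.cardinal_eq_cardinal_transcendence_basis_of_aleph0_lt _ hu
      (by simp) hK
    simpa using this.symm
  -- Removing a finite set does not change the uncountable cardinality of a transcendence basis, so
  -- `x i ↦ y i` extends to a bijection of the two bases.
  have diff (u a : Set K) (hau : a ⊆ u) (ha : a.Finite) (hu : #u = #K) :
      #(u \ a : Set K) = #K := by
    have h := mk_sdiff_add_mk hau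
    have ha' : #a < ℵ₀ := lt_aleph0_iff_set_finite.2 ha
    rw [hu, add_comm] at h
    exact eq_of_add_eq_of_aleph0_le h (ha'.trans hK) hK.le
  have e1 : (s \ Set.range x : Set K) ≃ (t \ Set.range y : Set K) :=
    Classical.choice <| Cardinal.eq.1 <|
      (diff s _ hxs (Set.finite_range x) (card s hs)).trans
        (diff t _ hyt (Set.finite_range y) (card t ht)).symm
  let e2 : Set.range x ≃ Set.range y :=
    (Equiv.ofInjective x hx.injective).symm.trans (Equiv.ofInjective y hy.injective)
  let e : s ≃ t := (Equiv.Set.sumDiffSubset hxs).symm.trans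
    ((e2.sumCongr e1).trans (Equiv.Set.sumDiffSubset hyt))
  have he (i : ι) : (e ⟨x i, hxs (Set.mem_range_self i)⟩ : K) = y i := by
    have h1 : (Equiv.Set.sumDiffSubset hxs).symm ⟨x i, hxs (Set.mem_range_self i)⟩ =
        Sum.inl ⟨x i, Set.mem_range_self i⟩ := by rw [Equiv.symm_apply_eq]; rfl
    have h2 : (Equiv.ofInjective x hx.injective).symm ⟨x i, Set.mem_range_self i⟩ = i :=
      Equiv.ofInjective_symm_apply hx.injective i
    simp only [e, e2, Equiv.trans_apply, h1, Equiv.sumCongr_apply, Sum.map_inl, h2]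
    rfl
  obtain ⟨σ, hσ⟩ := exists_algEquiv_of_isTranscendenceBasis hs
    ((isTranscendenceBasis_equiv e).2 ht)
  exact ⟨σ, fun i ↦ (hσ ⟨x i, hxs (Set.mem_range_self i)⟩).trans (he i)⟩

end Automorphisms

open Filter Topology

/-! ### Algebraic rigidity and finiteness -/

section Polynomials

variable {V K : Type*}

/-- The set of squared edge lengths of a realisation of `G`. -/
def lengthSet [CommRing K] (G : SimpleGraph V) (p : Realisation V K) : Set K :=
  {x | ∃ u v, G.Adj u v ∧ sqLen (p u - p v) = x}

/-- The realisation whose coordinates are indeterminates. -/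
noncomputable def universalPoint (V : Type*) : Realisation V (MvPolynomial (V × Fin 2) ℚ) :=
  fun v i ↦ MvPolynomial.X (v, i)

/-- Evaluation of polynomials in the coordinates at a realisation. -/
noncomputable def evalAt [Field K] [CharZero K] (p : Realisation V K) :
    MvPolynomial (V × Fin 2) ℚ →ₐ[ℚ] K :=
  MvPolynomial.aeval fun i ↦ p i.1 i.2

/-- The squared distance between `u` and `v`, as a polynomial. -/
noncomputable def distPoly (u v : V) : MvPolynomial (V × Fin 2) ℚ :=
  sqLen (universalPoint V u - universalPoint V v)

/-- All squared distances are algebraic over the algebra generated by the squared lengths of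
the edges, as polynomials in the coordinates. -/
def IsAlgRigid (G : SimpleGraph V) : Prop :=
  ∀ u v : V, IsAlgebraic (Algebra.adjoin ℚ (lengthSet G (universalPoint V))) (distPoly u v)

theorem evalAt_distPoly [Field K] [CharZero K] (p : Realisation V K) (u v : V) :
    evalAt p (distPoly u v) = sqLen (p u - p v) := by
  simp [evalAt, distPoly, sqLen, universalPoint]

theorem IsGeneric.injective_evalAt [Field K] [CharZero K] {p : Realisation V K}
    (hp : IsGeneric p) : Function.Injective (evalAt p) := hp

theorem image_evalAt_lengthSet [Field K] [CharZero K] (G : SimpleGraph V)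
    (p : Realisation V K) : evalAt p '' lengthSet G (universalPoint V) = lengthSet G p := by
  ext x
  constructor
  · rintro ⟨_, ⟨u, v, h, rfl⟩, rfl⟩
    exact ⟨u, v, h, (evalAt_distPoly p u v).symm⟩
  · rintro ⟨u, v, h, rfl⟩
    exact ⟨_, ⟨u, v, h, rfl⟩, evalAt_distPoly p u v⟩

theorem lengthSet_congr [CommRing K] {G : SimpleGraph V} {p q : Realisation V K}
    (h : IsEquivalent G p q) : lengthSet G p = lengthSet G q := by
  ext x
  exact ⟨fun ⟨u, v, e, hx⟩ ↦ ⟨u, v, e, (h u v e).symm.trans hx⟩,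
    fun ⟨u, v, e, hx⟩ ↦ ⟨u, v, e, (h u v e).trans hx⟩⟩

/-- Algebraicity of a polynomial over others may be tested after an injective evaluation. -/
theorem isAlgebraic_adjoin_image_iff {R A B : Type*} [CommRing R] [CommRing A] [CommRing B]
    [Algebra R A] [Algebra R B] (φ : A →ₐ[R] B) (hφ : Function.Injective φ) (s : Set A) (a : A) :
    IsAlgebraic (Algebra.adjoin R (φ '' s)) (φ a) ↔ IsAlgebraic (Algebra.adjoin R s) a := by
  rw [← AlgHom.map_adjoin]
  let f : Algebra.adjoin R s →+* (Algebra.adjoin R s).map φ :=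
    ((φ.comp (Algebra.adjoin R s).val).codRestrict _ fun x ↦ ⟨x, x.2, rfl⟩ :
      Algebra.adjoin R s →ₐ[R] (Algebra.adjoin R s).map φ)
  have hf : Function.Surjective f := by
    rintro ⟨_, x, hx, rfl⟩
    exact ⟨⟨x, hx⟩, rfl⟩
  have hfi : Function.Injective f := fun x y h ↦
    Subtype.ext (hφ (congrArg Subtype.val h))
  have hc : RingHom.comp (algebraMap ((Algebra.adjoin R s).map φ) B) f =
      RingHom.comp (φ : A →+* B) (algebraMap (Algebra.adjoin R s) A) := rfl
  exact ⟨fun h ↦ h.of_ringHom_of_comp_eq f (φ : A →+* B) hf hφ hc,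
    fun h ↦ h.ringHom_of_comp_eq f (φ : A →+* B) hfi hc⟩

/-- Evaluation at a generic point is injective on polynomials, so the condition can be tested at any
one generic realisation, real or complex. -/
theorem isAlgRigid_iff [Field K] [CharZero K] {G : SimpleGraph V} {p : Realisation V K}
    (hp : IsGeneric p) : IsAlgRigid G ↔
      ∀ u v, IsAlgebraic (Algebra.adjoin ℚ (lengthSet G p)) (sqLen (p u - p v)) := by
  refine forall₂_congr fun u v ↦ ?_
  rw [← isAlgebraic_adjoin_image_iff (evalAt p) hp.injective_evalAt, image_evalAt_lengthSet,
    evalAt_distPoly]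

/-- If `a` is algebraic over a subalgebra `S`, then the homomorphisms which agree on `S` with a
given injective one take only finitely many values at `a`. -/
theorem exists_polynomial_eval_eq_zero {R A B : Type*} [CommRing R] [CommRing A] [CommRing B]
    [Algebra R A] [Algebra R B] {S : Subalgebra R A} {a : A} (ha : IsAlgebraic S a)
    (φ : A →ₐ[R] B) (hφ : Function.Injective φ) :
    ∃ P : Polynomial B, P ≠ 0 ∧ ∀ ψ : A →ₐ[R] B, (∀ s ∈ S, φ s = ψ s) → P.eval (ψ a) = 0 := by
  obtain ⟨Q, hQ, hQa⟩ := ha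
  -- A homomorphism agreeing with `φ` on `S` maps the coefficients of `Q` to the same polynomial;
  -- injectivity of `φ` keeps it nonzero.
  refine ⟨Q.map (φ.comp S.val : S →+* B), ?_, fun ψ hψ ↦ ?_⟩
  · rwa [Ne, Polynomial.map_eq_zero_iff]
    exact fun x y h ↦ Subtype.ext (hφ h)
  · have : (φ.comp S.val : S →+* B) = (ψ : A →+* B).comp (algebraMap S A) :=
      RingHom.ext fun s ↦ hψ s s.2
    rw [Polynomial.eval_map, this]
    exact (Polynomial.hom_eval₂ Q (algebraMap S A) (ψ : A →+* B) a).symm.trans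
      ((congrArg ψ hQa).trans (map_zero ψ))

theorem exists_polynomial_of_isEquivalent [Field K] [CharZero K] {G : SimpleGraph V}
    {p : Realisation V K} (hp : IsGeneric p) {u v : V}
    (h : IsAlgebraic (Algebra.adjoin ℚ (lengthSet G (universalPoint V))) (distPoly u v)) :
    ∃ P : Polynomial K, P ≠ 0 ∧
      ∀ q, IsEquivalent G p q → P.eval (sqLen (q u - q v)) = 0 := by
  obtain ⟨P, hP, hq⟩ := exists_polynomial_eval_eq_zero h (evalAt p) hp.injective_evalAt
  refine ⟨P, hP, fun q hpq ↦ ?_⟩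
  rw [← evalAt_distPoly]
  refine hq _ fun s hs ↦ ?_
  refine AlgHom.adjoin_le_equalizer (evalAt p) (evalAt q) ?_ hs
  rintro _ ⟨u, v, huv, rfl⟩
  exact (evalAt_distPoly p u v).trans ((hpq u v huv).trans (evalAt_distPoly q u v).symm)

/-- There are finitely many congruence classes if the graph is algebraically rigid. -/
theorem IsAlgRigid.finite_quotient [Finite V] {G : SimpleGraph V} (hG : IsAlgRigid G)
    {p : Realisation V ℂ} (hp : IsGeneric p) : Finite (Quotient (congruenceSetoid G p)) := by
  choose P hP hq using fun u v ↦ exists_polynomial_of_isEquivalent hp (hG u v)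
  have (u v : V) : Finite {x : ℂ // (P u v).IsRoot x} :=
    (Polynomial.finite_setOfPred_isRoot (hP u v)).to_subtype
  -- A class is determined by its table of squared distances, and each entry is a root of a fixed
  -- nonzero polynomial.
  let f : Quotient (congruenceSetoid G p) → ∀ u v : V, {x : ℂ // (P u v).IsRoot x} :=
    Quotient.lift (fun q u v ↦ ⟨sqLen (q.1 u - q.1 v), hq u v q.1 q.2⟩)
      fun q q' h ↦ funext₂ fun u v ↦ Subtype.ext (h u v)
  refine Finite.of_injective f ?_
  rintro ⟨q⟩ ⟨q'⟩ h
  exact Quotient.sound fun u v ↦ congrArg Subtype.val (congrFun₂ h u v)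

end Polynomials

/-! ### Algebraic rigidity implies rigidity -/

section Real

variable {V : Type*}

theorem continuous_sqLen_sub (u v : V) :
    Continuous fun q : Realisation V ℝ ↦ sqLen (q u - q v) := by
  simp only [sqLen, Pi.sub_apply]
  fun_prop

variable [Finite V]

theorem isRigidFramework_iff_eventually {G : SimpleGraph V} {p : Realisation V ℝ} :
    IsRigidFramework G p ↔ ∀ᶠ q in 𝓝 p, IsEquivalent G p q → IsCongruent p q := by
  have := Fintype.ofFinite V
  constructor
  · rintro ⟨ε, hε, h⟩
    have : ∀ᶠ q in 𝓝 p, ∀ v, sqLen (p v - q v) < ε := by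
      refine eventually_all.2 fun v ↦ ?_
      have hc : Continuous fun q : Realisation V ℝ ↦ sqLen (p v - q v) := by
        simp only [sqLen, Pi.sub_apply]
        fun_prop
      refine hc.continuousAt.eventually_lt continuousAt_const ?_
      simpa [sqLen] using hε
    filter_upwards [this] with q hq hpq using h q hpq hq
  · intro h
    obtain ⟨r, hr, h⟩ := Metric.eventually_nhds_iff.1 h
    refine ⟨r ^ 2, by positivity, fun q hpq hq ↦ h ?_ hpq⟩
    refine (dist_pi_lt_iff hr).2 fun v ↦ (dist_pi_lt_iff hr).2 fun i ↦ ?_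
    have h1 := hq v
    simp only [sqLen, Pi.sub_apply] at h1
    rw [Real.dist_eq, abs_sub_comm]
    refine abs_lt_of_sq_lt_sq ?_ hr.le
    fin_cases i
    · exact lt_of_le_of_lt (le_add_of_nonneg_right (sq_nonneg _)) h1
    · exact lt_of_le_of_lt (le_add_of_nonneg_left (sq_nonneg _)) h1

/-- A continuous function with values among the roots of a nonzero polynomial is locally
constant. -/
theorem eventually_eq_of_polynomial {X : Type*} [TopologicalSpace X] {f : X → ℝ} {a : X}
    (hf : ContinuousAt f a) {P : Polynomial ℝ} (hP : P ≠ 0) :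
    ∀ᶠ x in 𝓝 a, P.eval (f x) = 0 → f x = f a := by
  have hfin : ({x | P.IsRoot x} \ {f a}).Finite :=
    (Polynomial.finite_setOfPred_isRoot hP).subset Set.sdiff_subset
  have : ∀ᶠ y in 𝓝 (f a), y ∉ ({x | P.IsRoot x} \ {f a}) :=
    hfin.isClosed.isOpen_compl.mem_nhds (by simp)
  filter_upwards [hf.eventually this] with x hx h0
  by_contra hne
  exact hx ⟨h0, hne⟩

/-- On equivalent realisations each squared distance is confined to the finitely many roots of a
polynomial; by continuity it is constant near `p`. -/
theorem IsAlgRigid.isRigid {G : SimpleGraph V} (hG : IsAlgRigid G) : IsRigid G := by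
  intro p hp
  rw [isRigidFramework_iff_eventually]
  choose P hP hq using fun u v ↦ exists_polynomial_of_isEquivalent hp (hG u v)
  have : ∀ᶠ q in 𝓝 p, ∀ u v, (P u v).eval (sqLen (q u - q v)) = 0 →
      sqLen (q u - q v) = sqLen (p u - p v) :=
    eventually_all.2 fun u ↦ eventually_all.2 fun v ↦
      eventually_eq_of_polynomial (continuous_sqLen_sub u v).continuousAt (hP u v)
  filter_upwards [this] with q h hpq u v using (h u v (hq u v q hpq)).symm

end Real

open Filter Topology

/-! ### Existence of generic realisations -/

section Generic

open Cardinal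

/-- With a finite basis, `ℝ` would be algebraic over a countable ring, hence countable. -/
theorem infinite_of_isTranscendenceBasis_real {s : Set ℝ}
    (hs : IsTranscendenceBasis ℚ ((↑) : s → ℝ)) : Infinite s := by
  by_contra hfin
  rw [not_infinite_iff_finite] at hfin
  have := hs.isAlgebraic
  have h := Algebra.IsAlgebraic.cardinalMk_le_max
    (Algebra.adjoin ℚ (Set.range ((↑) : s → ℝ))) ℝ
  have h2 : #(Algebra.adjoin ℚ (Set.range ((↑) : s → ℝ))) ≤ ℵ₀ := by
    rw [← Cardinal.mk_congr hs.1.aevalEquiv.toEquiv]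
    refine MvPolynomial.cardinalMk_le_max.trans ?_
    simp [Cardinal.mk_le_aleph0]
  rw [max_eq_right h2, Cardinal.mk_real] at h
  exact absurd h (not_le.2 Cardinal.aleph0_lt_continuum)

theorem exists_isGeneric_real (V : Type*) [Finite V] : ∃ p : Realisation V ℝ, IsGeneric p := by
  obtain ⟨s, hs⟩ := exists_isTranscendenceBasis ℚ ℝ
  have := infinite_of_isTranscendenceBasis_real hs
  obtain ⟨n, ⟨e⟩⟩ := Finite.exists_equiv_fin (V × Fin 2)
  let f : V × Fin 2 → s := fun i ↦ Infinite.natEmbedding s (e i)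
  have hf : Function.Injective f := fun i j h ↦
    e.injective (Fin.ext ((Infinite.natEmbedding s).injective h))
  exact ⟨fun v i ↦ f (v, i), hs.1.comp f hf⟩

theorem IsGeneric.ofReal {V : Type*} {p : Realisation V ℝ} (hp : IsGeneric p) :
    IsGeneric fun v i ↦ (p v i : ℂ) := by
  have h := AlgebraicIndependent.map' (f := Complex.ofRealAm.restrictScalars ℚ) hp
    Complex.ofReal_injective
  exact h

end Generic

/-! ### Transcendence bases as local coordinates -/

section Derivative

/-- A derivation, presented as a homomorphism to the dual numbers, which vanishes on a
subalgebra in characteristic zero vanishes on all elements algebraic over it. -/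
theorem snd_eq_zero_of_isAlgebraic {R A B : Type*} [CommRing R] [CommRing A] [IsDomain A]
    [CharZero A] [CommRing B] [IsDomain B] [Algebra R A] [Algebra R B] (φ : A →ₐ[R] DualNumber B)
    (hφ : ∀ a, (φ a).fst = 0 → a = 0) {S : Subalgebra R A} (hS : ∀ s ∈ S, (φ s).snd = 0)
    {a : A} (ha : IsAlgebraic S a) : (φ a).snd = 0 := by
  -- The chain rule; there is no term from the coefficients, because the derivation vanishes on `S`.
  have key (Q : Polynomial S) : (φ (Q.aeval a)).snd =
      (φ (Q.derivative.aeval a)).fst * (φ a).snd := by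
    induction Q using Polynomial.induction_on' with
    | add P Q hP hQ => simp [hP, hQ, add_mul]
    | monomial n c =>
      have hc : (φ (algebraMap S A c)).snd = 0 := hS c c.2
      simp only [Polynomial.aeval_monomial, Polynomial.derivative_monomial, map_mul, map_pow,
        map_natCast, TrivSqZeroExt.snd_mul, hc, TrivSqZeroExt.snd_pow, TrivSqZeroExt.fst_mul,
        TrivSqZeroExt.fst_pow, TrivSqZeroExt.fst_natCast, smul_eq_mul, nsmul_eq_mul,
        smul_zero, add_zero, Nat.pred_eq_sub_one]
      ring
  classical
  -- For an annihilating polynomial of minimal degree, the derivative does not vanish at `a`.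
  have hex : ∃ n, ∃ Q : Polynomial S, Q ≠ 0 ∧ Q.aeval a = 0 ∧ Q.natDegree = n := by
    obtain ⟨Q, hQ, hQa⟩ := ha
    exact ⟨_, Q, hQ, hQa, rfl⟩
  obtain ⟨Q, hQ, hQa, hdeg⟩ := Nat.find_spec hex
  have hd : Q.natDegree ≠ 0 := by
    intro h0
    rw [Polynomial.eq_C_of_natDegree_eq_zero h0, Polynomial.aeval_C] at hQa
    apply hQ
    rw [Polynomial.eq_C_of_natDegree_eq_zero h0]
    have : Q.coeff 0 = 0 := Subtype.ext hQa
    rw [this, map_zero]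
  have hlt := Polynomial.natDegree_derivative_lt hd
  have hne : Q.derivative.aeval a ≠ 0 := by
    intro h0
    refine Nat.find_min hex (hdeg ▸ hlt) ⟨Q.derivative, ?_, h0, rfl⟩
    intro h
    exact hd (Polynomial.derivative_eq_zero.1 h)
  have h := key Q
  rw [hQa, map_zero, TrivSqZeroExt.snd_zero] at h
  exact (mul_eq_zero.1 h.symm).resolve_left fun h ↦ hne (hφ _ h)

variable {V : Type*}

/-- Evaluation of polynomials at the point `p` with tangent vector `x`. -/
noncomputable def evalDual (p x : Realisation V ℝ) :
    MvPolynomial (V × Fin 2) ℚ →ₐ[ℚ] DualNumber ℝ :=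
  MvPolynomial.aeval fun i ↦ (TrivSqZeroExt.inl (p i.1 i.2) + TrivSqZeroExt.inr (x i.1 i.2))

theorem evalDual_X (p x : Realisation V ℝ) (i : V × Fin 2) :
    evalDual p x (MvPolynomial.X i) =
      TrivSqZeroExt.inl (p i.1 i.2) + TrivSqZeroExt.inr (x i.1 i.2) := by
  simp [evalDual]

theorem fst_evalDual (p x : Realisation V ℝ) (f : MvPolynomial (V × Fin 2) ℚ) :
    (evalDual p x f).fst = evalAt p f := by
  have : (TrivSqZeroExt.fstHom ℚ ℝ ℝ).comp (evalDual p x) = evalAt p := by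
    ext i
    simp [evalDual_X, evalAt]
  exact DFunLike.congr_fun this f

variable [Fintype V]

theorem exists_hasStrictFDerivAt_evalAt (p : Realisation V ℝ)
    (f : MvPolynomial (V × Fin 2) ℚ) : ∃ L : Realisation V ℝ →L[ℝ] ℝ,
      HasStrictFDerivAt (fun x : Realisation V ℝ ↦ evalAt x f) L p ∧
        ∀ x, L x = (evalDual p x f).snd := by
  induction f using MvPolynomial.induction_on with
  | C a =>
    refine ⟨0, ?_, fun x ↦ ?_⟩
    · simpa [evalAt] using hasStrictFDerivAt_const _ _
    · simp [evalDual, TrivSqZeroExt.algebraMap_eq_inl']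
  | add f g hf hg =>
    obtain ⟨L, hL, hL'⟩ := hf
    obtain ⟨N, hN, hN'⟩ := hg
    exact ⟨L + N, by simpa only [map_add] using hL.fun_add hN, fun x ↦ by simp [hL', hN']⟩
  | mul_X f i hf =>
    obtain ⟨L, hL, hL'⟩ := hf
    let N : Realisation V ℝ →L[ℝ] ℝ :=
      (ContinuousLinearMap.proj (R := ℝ) (φ := fun _ : Fin 2 ↦ ℝ) i.2).comp
        (ContinuousLinearMap.proj (R := ℝ) (φ := fun _ : V ↦ Fin 2 → ℝ) i.1)
    have hN : HasStrictFDerivAt (fun x : Realisation V ℝ ↦ evalAt x (MvPolynomial.X i)) N p := by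
      simp only [evalAt, MvPolynomial.aeval_X]
      exact N.hasStrictFDerivAt
    refine ⟨_, by simpa only [map_mul] using hL.fun_mul hN, fun x ↦ ?_⟩
    simp only [map_mul, TrivSqZeroExt.snd_mul, fst_evalDual, ← hL', evalDual_X]
    simp [N, evalAt, mul_comm]

/-- A transcendence basis consisting of polynomials gives local coordinates at a generic
point. -/
theorem map_nhds_evalAt {p : Realisation V ℝ} (hp : IsGeneric p)
    {B : Set (MvPolynomial (V × Fin 2) ℚ)} (hB : IsTranscendenceBasis ℚ ((↑) : B → MvPolynomial (V × Fin 2) ℚ)) :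
    map (fun (x : Realisation V ℝ) (b : B) ↦ evalAt x b.1) (𝓝 p) =
      𝓝 fun b : B ↦ evalAt p b.1 := by
  have hcard : Cardinal.mk B = Cardinal.mk (V × Fin 2) :=
    hB.cardinalMk_eq (IsTranscendenceBasis.mvPolynomial (V × Fin 2) ℚ)
  obtain ⟨e⟩ := Cardinal.eq.1 hcard
  have : Fintype B := Fintype.ofEquiv _ e.symm
  choose L hL hL' using fun b : B ↦ exists_hasStrictFDerivAt_evalAt p b.1
  -- A strictly differentiable map with surjective derivative is locally open. Both spaces have
  -- dimension `2|V|`, so injectivity of the derivative suffices.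
  refine (hasStrictFDerivAt_pi' (Φ' := ContinuousLinearMap.pi L)
    |>.2 fun b ↦ hL b).map_nhds_eq_of_surj ?_
  rw [LinearMap.range_eq_top]
  refine (LinearMap.injective_iff_surjective_of_finrank_eq_finrank ?_).1 ?_
  · simp [Fintype.card_congr e, Module.finrank_pi_fintype]
  · rw [← LinearMap.ker_eq_bot, LinearMap.ker_eq_bot']
    intro x hx
    -- A tangent vector killed by all of `B` gives a derivation vanishing on the algebra of `B`,
    -- hence on every coordinate, each being algebraic over it.
    have hS : ∀ s ∈ Algebra.adjoin ℚ B, (evalDual p x s).snd = 0 := by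
      intro s hs
      induction hs using Algebra.adjoin_induction with
      | mem b hb => rw [← hL' ⟨b, hb⟩]; exact congrFun hx ⟨b, hb⟩
      | algebraMap r => simp [TrivSqZeroExt.algebraMap_eq_inl']
      | add f g _ _ hf hg => simp [hf, hg]
      | mul f g _ _ hf hg => simp [TrivSqZeroExt.snd_mul, hf, hg]
    have halg := hB.isAlgebraic
    rw [Subtype.range_coe] at halg
    funext v i
    have := snd_eq_zero_of_isAlgebraic (evalDual p x)
      (fun a h ↦ hp.injective_evalAt (by rw [← fst_evalDual p x, h, map_zero])) hS
      (halg.isAlgebraic (MvPolynomial.X (v, i)))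
    simpa [evalDual_X] using this

end Derivative

/-! ### Rigidity implies algebraic rigidity -/

section RealRigidity

open AlgebraicIndependent

variable {V : Type*} [Finite V]

/-- A squared distance transcendental over the edge lengths can serve as a local coordinate
alongside a basis of those lengths. Varying it alone yields nearby equivalent realisations that are
not congruent to `p`. -/
theorem isAlgRigid_of_isRigidFramework {G : SimpleGraph V} {p : Realisation V ℝ}
    (hp : IsGeneric p) (h : IsRigidFramework G p) : IsAlgRigid G := by
  classical
  have := Fintype.ofFinite V
  rw [isRigidFramework_iff_eventually] at h
  intro u v
  by_contra hu
  let N := matroid ℚ (MvPolynomial (V × Fin 2) ℚ)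
  have mem_closure {s : Set (MvPolynomial (V × Fin 2) ℚ)} {a} :
      a ∈ N.closure s ↔ IsAlgebraic (Algebra.adjoin ℚ s) a := by
    rw [matroid_closure_eq]; rfl
  obtain ⟨F, hF⟩ := N.exists_isBasis (lengthSet G (universalPoint V))
  rw [← mem_closure, ← hF.closure_eq_closure] at hu
  have hi : N.Indep (insert (distPoly u v) F) :=
    (hF.indep.notMem_closure_iff (Set.mem_univ _)).1 hu |>.1
  obtain ⟨B, hB, hFB⟩ := hi.exists_isBase_superset
  have hmap := map_nhds_evalAt hp (matroid_isBase_iff.1 hB)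
  -- Only the lengths in `F` are coordinates. The remaining edge lengths are algebraic over them,
  -- hence locally constant once those in `F` are fixed.
  have hedge : ∀ a b, G.Adj a b → ∃ P : Polynomial ℝ, P ≠ 0 ∧ ∀ q : Realisation V ℝ,
      (∀ s ∈ F, evalAt q s = evalAt p s) → P.eval (sqLen (q a - q b)) = 0 := by
    intro a b hab
    have hmem : distPoly a b ∈ N.closure F := hF.subset_closure ⟨a, b, hab, rfl⟩
    obtain ⟨P, hP, hPq⟩ := exists_polynomial_eval_eq_zero (mem_closure.1 hmem) (evalAt p)
      hp.injective_evalAt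
    refine ⟨P, hP, fun q hq ↦ ?_⟩
    rw [← evalAt_distPoly]
    exact hPq _ fun s hs ↦
      AlgHom.adjoin_le_equalizer (evalAt p) (evalAt q) (fun s hs ↦ (hq s hs).symm) hs
  have hev : ∀ᶠ q in 𝓝 p, (∀ s ∈ F, evalAt q s = evalAt p s) → IsCongruent p q := by
    have : ∀ᶠ q in 𝓝 p, (∀ s ∈ F, evalAt q s = evalAt p s) → IsEquivalent G p q := by
      have h2 : ∀ᶠ q in 𝓝 p, ∀ a b, G.Adj a b → (∀ s ∈ F, evalAt q s = evalAt p s) →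
          sqLen (p a - p b) = sqLen (q a - q b) := by
        refine eventually_all.2 fun a ↦ eventually_all.2 fun b ↦ ?_
        by_cases hab : G.Adj a b
        · obtain ⟨P, hP, hPq⟩ := hedge a b hab
          filter_upwards [eventually_eq_of_polynomial (continuous_sqLen_sub a b).continuousAt hP]
            with q hq _ hF using (hq (hPq q hF)).symm
        · exact Eventually.of_forall fun q hab' ↦ absurd hab' hab
      filter_upwards [h2] with q hq hF a b hab using hq a b hab hF
    filter_upwards [this, h] with q hq hq' hF using hq' (hq hF)
  let Φ : Realisation V ℝ → B → ℝ := fun x b ↦ evalAt x b.1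
  let e' : B := ⟨distPoly u v, hFB (Set.mem_insert _ _)⟩
  have himg : ∀ᶠ y in 𝓝 (Φ p), ∃ q, Φ q = y ∧
      ((∀ s ∈ F, evalAt q s = evalAt p s) → IsCongruent p q) := by
    rw [← hmap]
    exact eventually_map.2 (hev.mono fun q hq ↦ ⟨q, rfl, hq⟩)
  -- The punctured neighbourhood guarantees a displacement `t ≠ 0` in the coordinate `e'`.
  have hcont : Tendsto (fun t : ℝ ↦ Function.update (Φ p) e' (Φ p e' + t)) (𝓝[≠] 0) (𝓝 (Φ p)) := by
    have : Continuous fun t : ℝ ↦ Function.update (Φ p) e' (Φ p e' + t) :=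
      continuous_const.update _ (continuous_const.add continuous_id)
    have h0 := this.tendsto 0
    simp only [add_zero, Function.update_eq_self] at h0
    exact h0.mono_left nhdsWithin_le_nhds
  obtain ⟨t, ⟨q, hq, hcong⟩, ht⟩ := ((hcont.eventually himg).and self_mem_nhdsWithin).exists
  have hqF : ∀ s ∈ F, evalAt q s = evalAt p s := by
    intro s hs
    have hne : (⟨s, hFB (Set.mem_insert_of_mem _ hs)⟩ : B) ≠ e' := by
      intro h
      have : s = distPoly u v := congrArg Subtype.val h
      exact hu (this ▸ N.subset_closure F (Set.subset_univ _) hs)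
    have h := congrFun hq ⟨s, hFB (Set.mem_insert_of_mem _ hs)⟩
    rwa [Function.update_of_ne hne] at h
  have h1 := congrFun hq e'
  rw [Function.update_self] at h1
  have h2 := hcong hqF u v
  rw [← evalAt_distPoly, ← evalAt_distPoly] at h2
  refine ht (?_ : t = 0)
  have h3 : evalAt q (distPoly u v) = evalAt p (distPoly u v) + t := h1
  linarith

theorem IsRigid.isAlgRigid {G : SimpleGraph V} (hG : IsRigid G) : IsAlgRigid G := by
  obtain ⟨p, hp⟩ := exists_isGeneric_real V
  exact isAlgRigid_of_isRigidFramework hp (hG p hp)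

theorem isRigid_iff_isAlgRigid {G : SimpleGraph V} : IsRigid G ↔ IsAlgRigid G :=
  ⟨IsRigid.isAlgRigid, IsAlgRigid.isRigid⟩

end RealRigidity

open AlgebraicIndependent

/-! ### The algebraic matroid of the complex numbers -/

section AlgebraicMatroid

/-- The matroid of algebraic independence over `ℚ` on the complex numbers. -/
noncomputable abbrev algMatroid : Matroid ℂ := matroid ℚ ℂ

theorem mem_closure_algMatroid {s : Set ℂ} {x : ℂ} :
    x ∈ algMatroid.closure s ↔ IsAlgebraic (Algebra.adjoin ℚ s) x := by
  rw [matroid_closure_eq]; rfl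

/-- The field of complex numbers which are algebraic over `s`. -/
noncomputable def algField (s : Set ℂ) : Subfield ℂ where
  carrier := algMatroid.closure s
  zero_mem' := mem_closure_algMatroid.2 isAlgebraic_zero
  one_mem' := mem_closure_algMatroid.2 isAlgebraic_one
  add_mem' ha hb := mem_closure_algMatroid.2
    ((mem_closure_algMatroid.1 ha).add (mem_closure_algMatroid.1 hb))
  mul_mem' ha hb := mem_closure_algMatroid.2
    ((mem_closure_algMatroid.1 ha).mul (mem_closure_algMatroid.1 hb))
  neg_mem' ha := mem_closure_algMatroid.2 (mem_closure_algMatroid.1 ha).neg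
  inv_mem' _ ha := mem_closure_algMatroid.2 (mem_closure_algMatroid.1 ha).inv

theorem mem_algField {s : Set ℂ} {x : ℂ} : x ∈ algField s ↔ x ∈ algMatroid.closure s := Iff.rfl

theorem subset_algField (s : Set ℂ) {x : ℂ} (hx : x ∈ s) : x ∈ algField s :=
  algMatroid.subset_closure s (Set.subset_univ _) hx

theorem eRk_le_of_subset_algField {s t : Set ℂ} (h : ∀ x ∈ s, x ∈ algField t) :
    algMatroid.eRk s ≤ algMatroid.eRk t := by
  rw [← algMatroid.eRk_closure_eq t]
  exact algMatroid.eRk_mono h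

theorem mem_algField_of_quadratic {s : Set ℂ} {a b c x : ℂ} (ha : a ∈ algField s)
    (hb : b ∈ algField s) (hc : c ∈ algField s) (ha0 : a ≠ 0)
    (h : a * x ^ 2 + b * x + c = 0) : x ∈ algField s := by
  have hcl : algMatroid.closure (algMatroid.closure s) = algMatroid.closure s :=
    algMatroid.closure_closure s
  rw [mem_algField, ← hcl, mem_closure_algMatroid]
  let S := Algebra.adjoin ℚ (algMatroid.closure s)
  let a' : S := ⟨a, Algebra.subset_adjoin ha⟩
  let b' : S := ⟨b, Algebra.subset_adjoin hb⟩
  let c' : S := ⟨c, Algebra.subset_adjoin hc⟩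
  refine ⟨Polynomial.C a' * Polynomial.X ^ 2 + Polynomial.C b' * Polynomial.X + Polynomial.C c',
    fun h0 ↦ ha0 ?_, ?_⟩
  · have := congrArg (fun P ↦ Polynomial.coeff P 2) h0
    simp only [Polynomial.coeff_add, Polynomial.coeff_C_mul, Polynomial.coeff_X_pow,
      Polynomial.coeff_X, Polynomial.coeff_C, Polynomial.coeff_zero] at this
    have h0 : a' = 0 := by simpa using this
    exact congrArg Subtype.val h0
  · simpa using h

theorem I_mem_algField (s : Set ℂ) : Complex.I ∈ algField s :=
  mem_algField_of_quadratic (one_mem _) (zero_mem _) (one_mem _) one_ne_zero (by simp)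

end AlgebraicMatroid

/-! ### Isotropic coordinates and rank bounds -/

section NullCoordinates

variable {V : Type*}

/-- Every planar complex realisation can be written in isotropic coordinates with `v₁` at the
origin and `v₂` in standard position. -/
theorem exists_nullCoordinates (q : Realisation V ℂ) (v₁ v₂ : V) :
    ∃ z w : V → ℂ, z v₁ = 0 ∧ w v₁ = 0 ∧
      (z v₂ = 1 ∧ w v₂ = sqLen (q v₁ - q v₂) ∨ z v₂ = 0 ∧ w v₂ = 1 ∨ z v₂ = 0 ∧ w v₂ = 0) ∧
      ∀ u v, sqLen (q u - q v) = (z u - z v) * (w u - w v) := by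
  let a : V → ℂ := fun v ↦ (q v 0 - q v₁ 0) + Complex.I * (q v 1 - q v₁ 1)
  let b : V → ℂ := fun v ↦ (q v 0 - q v₁ 0) - Complex.I * (q v 1 - q v₁ 1)
  have hab (u v : V) : sqLen (q u - q v) = (a u - a v) * (b u - b v) := by
    simp only [a, b, sqLen, Pi.sub_apply]
    linear_combination (q u 1 - q v 1) ^ 2 * Complex.I_sq
  have ha : a v₁ = 0 := by simp [a]
  have hb : b v₁ = 0 := by simp [b]
  -- Rotations act by `(z, w) ↦ (cz, w/c)`, so a nonzero coordinate of `v₂` can be scaled to `1`.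
  -- All three cases are needed, since `q` is arbitrary and `v₂ - v₁` may be isotropic.
  by_cases h : a v₂ = 0
  · by_cases h' : b v₂ = 0
    · exact ⟨a, b, ha, hb, Or.inr (Or.inr ⟨h, h'⟩), hab⟩
    · refine ⟨fun v ↦ b v₂ * a v, fun v ↦ b v / b v₂, by simp [ha], by simp [hb],
        Or.inr (Or.inl ⟨by simp [h], by simp [h']⟩), fun u v ↦ ?_⟩
      rw [hab]
      field_simp
  · refine ⟨fun v ↦ a v / a v₂, fun v ↦ a v₂ * b v, by simp [ha], by simp [hb],
      Or.inl ⟨by simp [h], by simp [hab, ha, hb]⟩, fun u v ↦ ?_⟩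
    rw [hab]
    field_simp

theorem mem_algField_image_compl_pair {f : V → ℂ} {v₁ v₂ : V} {s : Set ℂ}
    (h₁ : f v₁ ∈ algField s) (h₂ : f v₂ ∈ algField s) (hs : f '' {v₁, v₂}ᶜ ⊆ s) (v : V) :
    f v ∈ algField s := by
  by_cases hv : v ∈ ({v₁, v₂} : Set V)
  · rcases hv with rfl | rfl
    exacts [h₁, h₂]
  · exact subset_algField s (hs ⟨v, hv, rfl⟩)

theorem IsGeneric.sqLen_ne_zero {p : Realisation V ℂ} (hp : IsGeneric p) {u v : V}
    (h : u ≠ v) : sqLen (p u - p v) ≠ 0 := by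
  classical
  intro h0
  rw [← evalAt_distPoly] at h0
  have h1 : distPoly u v = 0 := hp.injective_evalAt (by rw [h0, map_zero])
  let q : Realisation V ℂ := fun x i ↦ if x = u ∧ i = 0 then 1 else 0
  have h2 := evalAt_distPoly q u v
  simp [h1, q, sqLen, h.symm] at h2

variable [Finite V]

theorem encard_image_compl_pair_le (f : V → ℂ) {v₁ v₂ : V} (h : v₁ ≠ v₂) :
    (f '' {v₁, v₂}ᶜ).encard ≤ (Nat.card V - 2 : ℕ) := by
  refine (Set.encard_image_le _ _).trans ?_
  rw [← Set.Finite.cast_ncard_eq (Set.toFinite _), Set.ncard_compl, Set.ncard_pair h]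

/-- Given the squared distance of two vertices, all squared distances depend on two further
parameters for each of the other vertices. -/
theorem eRk_lengthSet_union_le (q : Realisation V ℂ) {v₁ v₂ : V} (h : v₁ ≠ v₂) (X : Set ℂ) :
    algMatroid.eRk (lengthSet ⊤ q ∪ X) ≤
      algMatroid.eRk (insert (sqLen (q v₁ - q v₂)) X) + (2 * (Nat.card V - 2) : ℕ) := by
  obtain ⟨z, w, hz, hw, h2, hzw⟩ := exists_nullCoordinates q v₁ v₂
  set δ := sqLen (q v₁ - q v₂)
  let Y := z '' {v₁, v₂}ᶜ ∪ w '' {v₁, v₂}ᶜ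
  have hY : Y.encard ≤ (2 * (Nat.card V - 2) : ℕ) := by
    refine (Set.encard_union_le _ _).trans ?_
    rw [two_mul, Nat.cast_add]
    exact add_le_add (encard_image_compl_pair_le z h) (encard_image_compl_pair_le w h)
  have hδ : δ ∈ algField (insert δ X ∪ Y) := subset_algField _ (Or.inl (Or.inl rfl))
  have h2' : z v₂ ∈ algField (insert δ X ∪ Y) ∧ w v₂ ∈ algField (insert δ X ∪ Y) := by
    rcases h2 with ⟨h, h'⟩ | ⟨h, h'⟩ | ⟨h, h'⟩ <;> rw [h, h']
    · exact ⟨one_mem _, hδ⟩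
    · exact ⟨zero_mem _, one_mem _⟩
    · exact ⟨zero_mem _, zero_mem _⟩
  have hzm := mem_algField_image_compl_pair (s := insert δ X ∪ Y) (by rw [hz]; exact zero_mem _)
    h2'.1 (fun x hx ↦ Or.inr (Or.inl hx))
  have hwm := mem_algField_image_compl_pair (s := insert δ X ∪ Y) (by rw [hw]; exact zero_mem _)
    h2'.2 (fun x hx ↦ Or.inr (Or.inr hx))
  refine (eRk_le_of_subset_algField (t := insert δ X ∪ Y) ?_).trans
    ((algMatroid.eRk_union_le_eRk_add_encard _ _).trans (by gcongr))
  rintro x (⟨u, v, -, rfl⟩ | hx)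
  · rw [hzw]
    exact mul_mem (sub_mem (hzm u) (hzm v)) (sub_mem (hwm u) (hwm v))
  · exact subset_algField _ (Or.inl (Or.inr hx))

/-- The squared distances have rank at most `|V| - 1` for realisations on a line. -/
theorem eRk_lengthSet_le_of_collinear {q : Realisation V ℂ} {v₁ v₂ : V} (h : v₁ ≠ v₂)
    {z : V → ℂ} (h₁ : z v₁ = 0) (h₂ : z v₂ = 1)
    (hz : ∀ u v, sqLen (q u - q v) = sqLen (q v₁ - q v₂) * (z u - z v) ^ 2) :
    algMatroid.eRk (lengthSet ⊤ q) ≤ (1 + (Nat.card V - 2) : ℕ) := by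
  set δ := sqLen (q v₁ - q v₂)
  let Y := z '' {v₁, v₂}ᶜ
  have hzm := mem_algField_image_compl_pair (f := z) (s := {δ} ∪ Y)
    (by rw [h₁]; exact zero_mem _) (by rw [h₂]; exact one_mem _) (fun x hx ↦ Or.inr hx)
  refine (eRk_le_of_subset_algField (t := {δ} ∪ Y) ?_).trans
    ((algMatroid.eRk_le_encard _).trans ((Set.encard_union_le _ _).trans ?_))
  · rintro x ⟨u, v, -, rfl⟩
    rw [hz]
    exact mul_mem (subset_algField _ (Or.inl rfl)) (pow_mem (sub_mem (hzm u) (hzm v)) 2)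
  · rw [Nat.cast_add, Set.encard_singleton]
    exact add_le_add le_rfl (encard_image_compl_pair_le z h)

/-- The squared distances of a generic realisation have rank at least `2|V| - 3`. -/
theorem IsGeneric.le_eRk_lengthSet_top {p : Realisation V ℂ} (hp : IsGeneric p) {v₁ v₂ : V}
    (h : v₁ ≠ v₂) : (2 * Nat.card V : ℕ) ≤ algMatroid.eRk (lengthSet ⊤ p) + 3 := by
  let z : V → ℂ := fun v ↦ p v 0 + Complex.I * p v 1
  let w : V → ℂ := fun v ↦ p v 0 - Complex.I * p v 1
  have hzw (u v : V) : (z u - z v) * (w u - w v) = sqLen (p u - p v) := by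
    simp only [z, w, sqLen, Pi.sub_apply]
    linear_combination -(p u 1 - p v 1) ^ 2 * Complex.I_sq
  let C : Set ℂ := Set.range fun i : V × Fin 2 ↦ p i.1 i.2
  have hC : algMatroid.eRk C = (2 * Nat.card V : ℕ) := by
    have : algMatroid.Indep C := matroid_indep_iff.2 hp.to_subtype_range
    rw [this.eRk_eq_encard, show C = _ from Set.image_univ.symm, hp.injective.encard_image, Set.encard_univ,
      ENat.card_eq_coe_natCard, Nat.card_prod, Nat.card_fin, mul_comm]
  -- These three numbers fix the translation and the rotation; with them the distances determine all
  -- coordinates up to algebraicity.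
  let T : Set ℂ := {z v₁, w v₁, z v₂}
  have hT : T.encard ≤ 3 := by
    refine (Set.encard_insert_le _ _).trans ?_
    refine (add_le_add_left (Set.encard_insert_le _ _) 1).trans ?_
    rw [Set.encard_singleton]; norm_num
  let S := algField (lengthSet ⊤ p ∪ T)
  have hd (u v : V) : sqLen (p u - p v) ∈ S := by
    by_cases huv : u = v
    · simp [huv, sqLen]
    · exact subset_algField _ (Or.inl ⟨u, v, huv, rfl⟩)
  have hz1 : z v₁ ∈ S := subset_algField _ (Or.inr (by simp [T]))
  have hw1 : w v₁ ∈ S := subset_algField _ (Or.inr (by simp [T]))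
  have hz2 : z v₂ ∈ S := subset_algField _ (Or.inr (by simp [T]))
  have hne := hp.sqLen_ne_zero h.symm
  rw [← hzw] at hne
  have hα := left_ne_zero_of_mul hne
  have hβ := right_ne_zero_of_mul hne
  have hαm : z v₂ - z v₁ ∈ S := sub_mem hz2 hz1
  have hβm : w v₂ - w v₁ ∈ S := by
    have : w v₂ - w v₁ = sqLen (p v₂ - p v₁) / (z v₂ - z v₁) := by
      rw [← hzw]; field_simp
    rw [this]
    exact div_mem (hd _ _) hαm
  have hmem (v : V) : z v ∈ S ∧ w v ∈ S := by
    set A := sqLen (p v - p v₁) with hA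
    set B := sqLen (p v - p v₂) with hB
    rw [← hzw] at hA hB
    set α := z v₂ - z v₁
    set β := w v₂ - w v₁
    have hCm : A + α * β - B ∈ S := sub_mem (add_mem (hd _ _) (mul_mem hαm hβm)) (hd _ _)
    have ha : z v - z v₁ ∈ S := by
      -- With `a = z v - z v₁` and `b = w v - w v₁`, the equations `ab = A` and `(a - α)(b - β) = B`
      -- give `βa + αb = A + αβ - B`. Multiplying by `a` eliminates `b`.
      refine mem_algField_of_quadratic hβm (neg_mem hCm) (mul_mem hαm (hd v v₁)) hβ ?_
      change _ + α * A = 0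
      rw [hA, hB]
      ring
    have hb : w v - w v₁ ∈ S := by
      have : w v - w v₁ = ((A + α * β - B) - β * (z v - z v₁)) / α := by
        rw [eq_div_iff hα, hA, hB]
        ring
      rw [this]
      exact div_mem (sub_mem hCm (mul_mem hβm ha)) hαm
    exact ⟨by simpa using add_mem ha hz1, by simpa using add_mem hb hw1⟩
  have h2 : (2 : ℂ) ∈ S := ofNat_mem S 2
  rw [← hC]
  refine (eRk_le_of_subset_algField (t := lengthSet ⊤ p ∪ T) ?_).trans
    ((algMatroid.eRk_union_le_eRk_add_encard _ _).trans (by gcongr))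
  rintro _ ⟨⟨v, i⟩, rfl⟩
  obtain ⟨hz, hw⟩ := hmem v
  fin_cases i
  · have : p v 0 = (z v + w v) / 2 := by simp only [z, w]; ring
    simpa only [Fin.zero_eta, this] using div_mem (add_mem hz hw) h2
  · have : p v 1 = (z v - w v) / (2 * Complex.I) := by
      rw [eq_div_iff (by simp)]; simp only [z, w]; ring
    simpa only [Fin.mk_one, this] using div_mem (sub_mem hz hw) (mul_mem h2 (I_mem_algField _))

end NullCoordinates

open AlgebraicIndependent

/-! ### Rigidity as a rank condition -/

section Rank

variable {V : Type*}

theorem lengthSet_mono {K : Type*} [CommRing K] {G H : SimpleGraph V} (h : G ≤ H)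
    (p : Realisation V K) : lengthSet G p ⊆ lengthSet H p :=
  fun _ ⟨u, v, e, hx⟩ ↦ ⟨u, v, h e, hx⟩

theorem IsGeneric.comp_injective {W K : Type*} [Field K] [CharZero K] {p : Realisation V K}
    (hp : IsGeneric p) {f : W → V} (hf : Function.Injective f) : IsGeneric fun w ↦ p (f w) :=
  AlgebraicIndependent.comp hp (fun i : W × Fin 2 ↦ (f i.1, i.2)) fun _ _ h ↦
    Prod.ext (hf (Prod.ext_iff.1 h).1) (Prod.ext_iff.1 h).2

variable [Finite V]

theorem finite_lengthSet {K : Type*} [CommRing K] (G : SimpleGraph V) (p : Realisation V K) :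
    (lengthSet G p).Finite :=
  (Set.finite_range fun e : V × V ↦ sqLen (p e.1 - p e.2)).subset
    fun _ ⟨u, v, _, hx⟩ ↦ ⟨(u, v), hx⟩

theorem exists_eRk_lengthSet_eq (G : SimpleGraph V) (p : Realisation V ℂ) :
    ∃ k : ℕ, algMatroid.eRk (lengthSet G p) = k := by
  have h := (algMatroid.eRk_le_encard (lengthSet G p)).trans_lt
    (Set.encard_lt_top_iff.2 (finite_lengthSet G p))
  exact ⟨_, (ENat.natCast_toNat h.ne).symm⟩

theorem isAlgRigid_iff_eRk_le {G : SimpleGraph V} {p : Realisation V ℂ} (hp : IsGeneric p) :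
    IsAlgRigid G ↔ algMatroid.eRk (lengthSet ⊤ p) ≤ algMatroid.eRk (lengthSet G p) := by
  rw [isAlgRigid_iff hp]
  constructor
  · intro h
    refine eRk_le_of_subset_algField ?_
    rintro x ⟨u, v, -, rfl⟩
    exact mem_closure_algMatroid.2 (h u v)
  · intro h u v
    have hfin : algMatroid.IsRkFinite (lengthSet G p) := by
      rw [← Matroid.eRk_lt_top_iff]
      obtain ⟨k, hk⟩ := exists_eRk_lengthSet_eq G p
      rw [hk]
      exact ENat.natCast_lt_top k
    -- Nested sets of equal finite rank have the same closure.
    have hcl := hfin.closure_eq_closure_of_subset_of_eRk_ge_eRk (lengthSet_mono le_top p) h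
    rw [← mem_closure_algMatroid, hcl]
    by_cases huv : u = v
    · have h0 : sqLen (p u - p v) = 0 := by simp [huv, sqLen]
      rw [h0]
      exact zero_mem (algField (lengthSet ⊤ p))
    · exact subset_algField _ ⟨u, v, huv, rfl⟩

theorem eRk_lengthSet_top_le (q : Realisation V ℂ) {v₁ v₂ : V} (h : v₁ ≠ v₂) :
    algMatroid.eRk (lengthSet ⊤ q) ≤ (1 + 2 * (Nat.card V - 2) : ℕ) := by
  have h1 := eRk_lengthSet_union_le q h ∅
  rw [Set.union_empty] at h1
  refine h1.trans ?_
  rw [Nat.cast_add]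
  gcongr
  refine (algMatroid.eRk_le_encard _).trans ?_
  simp

/-- A graph is algebraically rigid if and only if the squared edge lengths of a generic
realisation have rank at least `2|V| - 3`. -/
theorem isAlgRigid_iff_le_eRk {G : SimpleGraph V} {p : Realisation V ℂ} (hp : IsGeneric p)
    {v₁ v₂ : V} (h : v₁ ≠ v₂) :
    IsAlgRigid G ↔ (1 + 2 * (Nat.card V - 2) : ℕ) ≤ algMatroid.eRk (lengthSet G p) := by
  rw [isAlgRigid_iff_eRk_le hp]
  refine ⟨fun hle ↦ ?_, (eRk_lengthSet_top_le p h).trans⟩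
  have h1 := hp.le_eRk_lengthSet_top h
  obtain ⟨k, hk⟩ := exists_eRk_lengthSet_eq ⊤ p
  rw [hk] at h1 hle
  have := (Finite.one_lt_card_iff_nontrivial (α := V)).2 ⟨v₁, v₂, h⟩
  refine le_trans ?_ hle
  norm_cast at h1 ⊢
  omega

end Rank

/-! ### Rank counts for a 2-separation -/

section Separation

variable {V : Type*} {G : SimpleGraph V} {G₁ G₂ : G.Subgraph}

theorem lengthSet_subset_union {K : Type*} [CommRing K] (h : G₁ ⊔ G₂ = ⊤)
    (p : Realisation V K) :
    lengthSet G p ⊆ lengthSet G₁.coe (fun v ↦ p v) ∪ lengthSet G₂.coe (fun v ↦ p v) := by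
  rintro x ⟨u, v, huv, rfl⟩
  have : (G₁ ⊔ G₂).Adj u v := by rw [h]; exact huv
  rcases SimpleGraph.Subgraph.sup_adj.1 this with h | h
  · exact Or.inl ⟨⟨u, h.fst_mem⟩, ⟨v, h.snd_mem⟩, h, rfl⟩
  · exact Or.inr ⟨⟨u, h.fst_mem⟩, ⟨v, h.snd_mem⟩, h, rfl⟩

variable [Finite V]

theorem IsSeparation.card_add_card (hsep : IsSeparation 2 G₁ G₂) :
    Nat.card G₁.verts + Nat.card G₂.verts = Nat.card V + 2 := by
  have h1 : G₁.verts ∪ G₂.verts = Set.univ := by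
    rw [← SimpleGraph.Subgraph.verts_sup, hsep.union_eq, SimpleGraph.Subgraph.verts_top]
  have h2 := Set.ncard_union_add_ncard_inter G₁.verts G₂.verts
  rw [h1, hsep.card_inter, Set.ncard_univ] at h2
  exact h2.symm

variable {a₁ b₁ : G₁.verts} {a₂ b₂ : G₂.verts} {p : Realisation V ℂ}

/-- The lengths of `G` have rank at least `2|V| - 3 = (2|V₁| - 3) + (2|V₂| - 4)`, and those of `G₂`
contribute at most `2|V₂| - 4`. -/
theorem IsSeparation.isAlgRigid_left (hsep : IsSeparation 2 G₁ G₂) (hp : IsGeneric p)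
    (hG : IsAlgRigid G) (hG₂ : ¬ IsAlgRigid G₂.coe) (h₁ : a₁ ≠ b₁) (h₂ : a₂ ≠ b₂) :
    IsAlgRigid G₁.coe := by
  have hcard := hsep.card_add_card
  have c₁ := hsep.card_left
  have c₂ := hsep.card_right
  rw [← Nat.card_coe_set_eq] at c₁ c₂
  rw [isAlgRigid_iff_le_eRk hp fun h ↦ h₁ (Subtype.ext h)] at hG
  rw [isAlgRigid_iff_le_eRk (hp.comp_injective (W := G₂.verts) Subtype.val_injective) h₂] at hG₂
  rw [isAlgRigid_iff_le_eRk (hp.comp_injective (W := G₁.verts) Subtype.val_injective) h₁]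
  have h := hG.trans ((algMatroid.eRk_mono (lengthSet_subset_union hsep.union_eq p)).trans
    (algMatroid.eRk_union_le_eRk_add_eRk _ _))
  obtain ⟨k₁, hk₁⟩ := exists_eRk_lengthSet_eq G₁.coe fun v ↦ p v
  obtain ⟨k₂, hk₂⟩ := exists_eRk_lengthSet_eq G₂.coe fun v ↦ p v
  rw [hk₁, hk₂] at h
  rw [hk₂] at hG₂
  rw [hk₁]
  norm_cast at h hG₂ ⊢
  omega

/-- The squared lengths of `G₂` together with the squared distance of the separating pair, in
any realisation of `G₁` equivalent to the given one, have full rank. -/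
theorem IsSeparation.le_eRk_insert (hsep : IsSeparation 2 G₁ G₂) (hp : IsGeneric p)
    (hG : IsAlgRigid G) (h₁ : a₁ ≠ b₁) {q : Realisation G₁.verts ℂ}
    (hq : IsEquivalent G₁.coe (fun v ↦ p v) q) :
    (1 + 2 * (Nat.card G₂.verts - 2) : ℕ) ≤
      algMatroid.eRk (insert (sqLen (q a₁ - q b₁)) (lengthSet G₂.coe fun v ↦ p v)) := by
  have hcard := hsep.card_add_card
  have c₁ := hsep.card_left
  have c₂ := hsep.card_right
  rw [← Nat.card_coe_set_eq] at c₁ c₂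
  rw [isAlgRigid_iff_le_eRk hp fun h ↦ h₁ (Subtype.ext h)] at hG
  have h := algMatroid.eRk_mono (lengthSet_subset_union hsep.union_eq p)
  rw [lengthSet_congr hq] at h
  -- Once `δ` and the lengths of `G₂` are given, the distances of `q` add at most `2(|V₁| - 2)` to
  -- the rank; subtracting this from `2|V| - 3` leaves `2|V₂| - 3`.
  have h2 := (hG.trans h).trans ((algMatroid.eRk_mono (Set.union_subset_union_left _
    (lengthSet_mono le_top q))).trans
      (eRk_lengthSet_union_le q h₁ (lengthSet G₂.coe fun v ↦ p v)))
  generalize algMatroid.eRk (insert _ _) = r at h2 ⊢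
  induction r using ENat.recTopCoe with
  | top => exact le_top
  | coe r =>
    norm_cast at h2 ⊢
    omega

/-- If `δ` were algebraic over the lengths of `G₂`, these would already have full rank and `G₂`
would be rigid. -/
theorem IsSeparation.notMem_closure (hsep : IsSeparation 2 G₁ G₂) (hp : IsGeneric p)
    (hG : IsAlgRigid G) (hG₂ : ¬ IsAlgRigid G₂.coe) (h₁ : a₁ ≠ b₁) (h₂ : a₂ ≠ b₂)
    {q : Realisation G₁.verts ℂ} (hq : IsEquivalent G₁.coe (fun v ↦ p v) q) :
    sqLen (q a₁ - q b₁) ∉ algField (lengthSet G₂.coe fun v ↦ p v) := by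
  intro hmem
  refine hG₂ ((isAlgRigid_iff_le_eRk (hp.comp_injective (W := G₂.verts) Subtype.val_injective) h₂).2 ?_)
  refine (hsep.le_eRk_insert hp hG h₁ hq).trans (eRk_le_of_subset_algField ?_)
  rintro x (rfl | hx)
  · exact hmem
  · exact subset_algField _ hx

theorem IsSeparation.isAlgRigid_right (hsep : IsSeparation 2 G₁ G₂) (hp : IsGeneric p)
    (hG : IsAlgRigid G) (h₁ : a₁ ≠ b₁) (h₂ : a₂ ≠ b₂) (ha : (a₁ : V) = a₂) (hb : (b₁ : V) = b₂) :
    IsAlgRigid (G₂.coe ⊔ SimpleGraph.edge a₂ b₂) := by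
  rw [isAlgRigid_iff_le_eRk (hp.comp_injective (W := G₂.verts) Subtype.val_injective) h₂]
  refine (hsep.le_eRk_insert hp hG h₁ (q := fun v ↦ p v) fun _ _ _ ↦ rfl).trans
    (algMatroid.eRk_mono (Set.insert_subset ?_ (lengthSet_mono le_sup_left _)))
  exact ⟨a₂, b₂, Or.inr (by simp [SimpleGraph.edge_adj, h₂]), by rw [ha, hb]⟩

end Separation

/-! ### Independence of the generic realisation -/

section Conjugation

variable {V : Type*}

open Cardinal in
theorem aleph0_lt_mk_complex : ℵ₀ < #ℂ := by
  rw [Cardinal.mk_complex]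
  exact Cardinal.aleph0_lt_continuum

theorem sqLen_map {K L : Type*} [CommRing K] [CommRing L] (σ : K →+* L) (P Q : Fin 2 → K) :
    sqLen ((fun i ↦ σ (P i)) - fun i ↦ σ (Q i)) = σ (sqLen (P - Q)) := by
  simp [sqLen]

/-- The number of congruence classes does not depend on the generic realisation. -/
theorem numClasses_eq_of_isGeneric [Finite V] (G : SimpleGraph V) {p p' : Realisation V ℂ}
    (hp : IsGeneric p) (hp' : IsGeneric p') : numClasses G p = numClasses G p' := by
  obtain ⟨σ, hσ⟩ := exists_algEquiv_of_algebraicIndependent aleph0_lt_mk_complex hp hp'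
  have hσ' : (fun v i ↦ σ (p v i)) = p' := funext₂ fun v i ↦ hσ (v, i)
  have map_eq (q : Realisation V ℂ) (u v : V) :
      sqLen ((fun i ↦ σ (q u i)) - fun i ↦ σ (q v i)) = σ (sqLen (q u - q v)) :=
    sqLen_map (σ : ℂ →+* ℂ) _ _
  let e : {q : Realisation V ℂ // IsEquivalent G p q} ≃
      {q : Realisation V ℂ // IsEquivalent G p' q} :=
    Equiv.subtypeEquiv (Equiv.piCongrRight fun _ ↦ Equiv.piCongrRight fun _ ↦ σ.toEquiv)
      fun q ↦ by
        rw [← hσ']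
        refine forall₃_congr fun u v _ ↦ ?_
        exact (σ.injective.eq_iff.symm.trans (by rw [← map_eq, ← map_eq]; rfl))
  refine ENat.card_congr (Quotient.congr e fun q q' ↦ forall₂_congr fun u v ↦ ?_)
  exact (σ.injective.eq_iff.symm.trans (by rw [← map_eq, ← map_eq]; rfl))

end Conjugation

/-! ### Realisations in standard position -/

section NormalForm

variable {V : Type*}

/-- The realisation with given isotropic coordinates. -/
noncomputable def ofNull (n : (V → ℂ) × (V → ℂ)) : Realisation V ℂ :=
  fun v ↦ ![(n.1 v + n.2 v) / 2, (n.1 v - n.2 v) / (2 * Complex.I)]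

theorem sqLen_ofNull (n : (V → ℂ) × (V → ℂ)) (u v : V) :
    sqLen (ofNull n u - ofNull n v) = (n.1 u - n.1 v) * (n.2 u - n.2 v) := by
  simp only [sqLen, ofNull, Pi.sub_apply, Matrix.cons_val_zero, Matrix.cons_val_one]
  have : (n.1 u - n.2 u) / (2 * Complex.I) - (n.1 v - n.2 v) / (2 * Complex.I) =
      ((n.1 u - n.2 u) - (n.1 v - n.2 v)) / (2 * Complex.I) := by ring
  rw [this, div_pow, mul_pow, Complex.I_sq]
  ring

/-- The isotropic coordinates of the realisations equivalent to `p` which are in standard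
position with respect to `a` and `b`. -/
def normalSet (G : SimpleGraph V) (p : Realisation V ℂ) (a b : V) : Set ((V → ℂ) × (V → ℂ)) :=
  {n | n.1 a = 0 ∧ n.2 a = 0 ∧ n.1 b = 1 ∧
    ∀ u v, G.Adj u v → (n.1 u - n.1 v) * (n.2 u - n.2 v) = sqLen (p u - p v)}

variable {G : SimpleGraph V} {p : Realisation V ℂ} {a b : V}

theorem isEquivalent_ofNull {n : (V → ℂ) × (V → ℂ)} (hn : n ∈ normalSet G p a b) :
    IsEquivalent G p (ofNull n) :=
  fun u v h ↦ by rw [sqLen_ofNull, hn.2.2.2 u v h]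

theorem sqLen_ofNull_base {n : (V → ℂ) × (V → ℂ)} (hn : n ∈ normalSet G p a b) :
    sqLen (ofNull n a - ofNull n b) = n.2 b := by
  rw [sqLen_ofNull, hn.1, hn.2.1, hn.2.2.1]; ring

/-- Reflection in the line through the base points. -/
noncomputable def reflect (b : V) (n : (V → ℂ) × (V → ℂ)) : (V → ℂ) × (V → ℂ) :=
  (fun v ↦ n.2 v / n.2 b, fun v ↦ n.2 b * n.1 v)

theorem reflect_mem {n : (V → ℂ) × (V → ℂ)} (hn : n ∈ normalSet G p a b) (hb : n.2 b ≠ 0) :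
    reflect b n ∈ normalSet G p a b := by
  refine ⟨by simp [reflect, hn.2.1], by simp [reflect, hn.1], by simp [reflect, hb],
    fun u v h ↦ ?_⟩
  rw [← hn.2.2.2 u v h]
  simp only [reflect]
  field_simp

theorem isCongruent_reflect {n : (V → ℂ) × (V → ℂ)} (hb : n.2 b ≠ 0) :
    IsCongruent (ofNull (reflect b n)) (ofNull n) := by
  intro u v
  rw [sqLen_ofNull, sqLen_ofNull]
  simp only [reflect]
  field_simp

/-- Up to scale, `δz + w` and `δz - w`, with `δ = n.2 b`, are the coordinates along and across the
base line. Distances determine the first (`h1`) and all products of the second (`h2`), so the second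
is determined up to one global sign once some vertex lies off the line. The reflection changes that
sign. -/
theorem eq_or_eq_reflect {n m : (V → ℂ) × (V → ℂ)} (hn : n ∈ normalSet G p a b)
    (hm : m ∈ normalSet G p a b) (hb : n.2 b ≠ 0) (hcol : ∃ v, n.2 v ≠ n.2 b * n.1 v)
    (h : IsCongruent (ofNull n) (ofNull m)) : m = n ∨ m = reflect b n := by
  have hδ : n.2 b = m.2 b := by
    rw [← sqLen_ofNull_base hn, ← sqLen_ofNull_base hm, h]
  have hd (u v : V) : (n.1 u - n.1 v) * (n.2 u - n.2 v) =
      (m.1 u - m.1 v) * (m.2 u - m.2 v) := by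
    rw [← sqLen_ofNull, ← sqLen_ofNull, h]
  have h0 (v : V) : n.1 v * n.2 v = m.1 v * m.2 v := by
    have := hd v a
    rwa [hn.1, hn.2.1, hm.1, hm.2.1, sub_zero, sub_zero, sub_zero, sub_zero] at this
  have h1 (v : V) : n.2 b * n.1 v + n.2 v = n.2 b * m.1 v + m.2 v := by
    have := hd v b
    rw [hn.2.2.1, hm.2.2.1, ← hδ] at this
    linear_combination h0 v - this
  have h2 (u v : V) : (n.2 b * n.1 u - n.2 u) * (n.2 b * n.1 v - n.2 v) =
      (n.2 b * m.1 u - m.2 u) * (n.2 b * m.1 v - m.2 v) := by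
    linear_combination (n.2 b * n.1 u + n.2 u) * h1 v + (n.2 b * m.1 v + m.2 v) * h1 u
      + 2 * n.2 b * (hd u v - h0 u - h0 v)
  obtain ⟨u, hu⟩ := hcol
  have hu' : n.2 b * n.1 u - n.2 u ≠ 0 := fun h ↦ hu (sub_eq_zero.1 h).symm
  rcases sq_eq_sq_iff_eq_or_eq_neg.1 ((pow_two _).trans ((h2 u u).trans (pow_two _).symm))
    with h3 | h3
  · left
    have h4 (v : V) : n.2 b * n.1 v - n.2 v = n.2 b * m.1 v - m.2 v :=
      mul_left_cancel₀ hu' ((h2 u v).trans (by rw [h3]))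
    refine Prod.ext (funext fun v ↦ mul_left_cancel₀ hb ?_) (funext fun v ↦ ?_)
    · linear_combination -(h1 v + h4 v) / 2
    · linear_combination -(h1 v - h4 v) / 2
  · right
    have h4 (v : V) : n.2 b * n.1 v - n.2 v = -(n.2 b * m.1 v - m.2 v) :=
      mul_left_cancel₀ hu' ((h2 u v).trans (by rw [h3]; ring))
    refine Prod.ext (funext fun v ↦ mul_left_cancel₀ hb ?_) (funext fun v ↦ ?_)
    · simp only [reflect]
      field_simp
      linear_combination (h4 v - h1 v) / 2
    · simp only [reflect]
      linear_combination -(h1 v + h4 v) / 2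

/-- A nonzero distance of the base points excludes the degenerate cases of `exists_nullCoordinates`.
-/
theorem exists_mem_normalSet {q : Realisation V ℂ} (hq : IsEquivalent G p q)
    (hb : sqLen (q a - q b) ≠ 0) : ∃ n ∈ normalSet G p a b, IsCongruent (ofNull n) q := by
  obtain ⟨z, w, hz, hw, h, hzw⟩ := exists_nullCoordinates q a b
  have hz1 : z b = 1 := by
    rcases h with h | h | h
    · exact h.1
    all_goals exact absurd (by rw [hzw, hz, hw, h.1]; ring) hb
  exact ⟨(z, w), ⟨hz, hw, hz1, fun u v e ↦ by rw [← hzw, hq u v e]⟩,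
    fun u v ↦ by rw [sqLen_ofNull, hzw]⟩

/-- Each congruence class consists of two realisations in standard position. -/
theorem card_normalSet (hb : ∀ q, IsEquivalent G p q → sqLen (q a - q b) ≠ 0)
    (hcol : ∀ n ∈ normalSet G p a b, ∃ v, n.2 v ≠ n.2 b * n.1 v) :
    Nat.card (normalSet G p a b) = 2 * Nat.card (Quotient (congruenceSetoid G p)) := by
  have hb' {n} (hn : n ∈ normalSet G p a b) : n.2 b ≠ 0 := by
    rw [← sqLen_ofNull_base hn]
    exact hb _ (isEquivalent_ofNull hn)
  let cl (n : normalSet G p a b) : Quotient (congruenceSetoid G p) :=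
    Quotient.mk _ ⟨ofNull n.1, isEquivalent_ofNull n.2⟩
  have cl_eq {n m : normalSet G p a b} (h : cl n = cl m) :
      IsCongruent (ofNull n.1) (ofNull m.1) := Quotient.exact h
  let τ (n : normalSet G p a b) : normalSet G p a b := ⟨reflect b n.1, reflect_mem n.2 (hb' n.2)⟩
  have hτ (n) : cl (τ n) = cl n := Quotient.sound (isCongruent_reflect (hb' n.2))
  have hτ' (n) : τ n ≠ n := by
    intro h
    obtain ⟨v, hv⟩ := hcol n.1 n.2
    exact hv (congrFun (congrArg (fun m ↦ m.1.2) h) v).symm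
  have hsurj : Function.Surjective cl := by
    rintro ⟨q, hq⟩
    obtain ⟨n, hn, hnq⟩ := exists_mem_normalSet hq (hb q hq)
    exact ⟨⟨n, hn⟩, Quotient.sound hnq⟩
  obtain ⟨s, hs⟩ := hsurj.hasRightInverse
  -- The Boolean selects the chosen representative of a class or its mirror image.
  let f (x : Bool × Quotient (congruenceSetoid G p)) : normalSet G p a b :=
    if x.1 then s x.2 else τ (s x.2)
  have hf (x) : cl (f x) = x.2 := by
    rcases x with ⟨_ | _, c⟩
    · exact (hτ _).trans (hs c)
    · exact hs c
  have hbij : Function.Bijective f := by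
    constructor
    · rintro ⟨i, c⟩ ⟨j, d⟩ h
      obtain rfl : c = d := (hf (i, c)).symm.trans ((congrArg cl h).trans (hf (j, d)))
      cases i <;> cases j
      · rfl
      · exact absurd h (hτ' _)
      · exact absurd h.symm (hτ' _)
      · rfl
    · intro n
      have h : cl (s (cl n)) = cl n := hs _
      rcases eq_or_eq_reflect (s (cl n)).2 n.2 (hb' (s (cl n)).2) (hcol _ (s (cl n)).2) (cl_eq h)
        with h | h
      · exact ⟨(true, cl n), Subtype.ext h.symm⟩
      · exact ⟨(false, cl n), Subtype.ext h.symm⟩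
  rw [← Nat.card_congr (Equiv.ofBijective f hbij), Nat.card_prod, Nat.card_eq_fintype_card,
    Fintype.card_bool]

/-- No realisation equivalent to a generic one of a rigid graph lies on a line. -/
theorem IsAlgRigid.not_collinear [Finite V] (hG : IsAlgRigid G) (hp : IsGeneric p)
    (hV : 3 ≤ Nat.card V) (hab : a ≠ b) {n : (V → ℂ) × (V → ℂ)} (hn : n ∈ normalSet G p a b) :
    ∃ v, n.2 v ≠ n.2 b * n.1 v := by
  by_contra! h
  have h1 := (isAlgRigid_iff_le_eRk hp hab).1 hG
  rw [lengthSet_congr (isEquivalent_ofNull hn)] at h1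
  -- On a line the rank is at most `|V| - 1`, which is less than `2|V| - 3` because `|V| ≥ 3`.
  have h2 := h1.trans ((algMatroid.eRk_mono (lengthSet_mono le_top _)).trans
    (eRk_lengthSet_le_of_collinear hab hn.1 hn.2.2.1 fun u v ↦ by
      rw [sqLen_ofNull_base hn, sqLen_ofNull, h u, h v]; ring))
  norm_cast at h2
  omega

theorem IsAlgRigid.card_normalSet [Finite V] (hG : IsAlgRigid G) (hp : IsGeneric p)
    (hV : 3 ≤ Nat.card V) (hab : a ≠ b)
    (hb : ∀ q, IsEquivalent G p q → sqLen (q a - q b) ≠ 0) :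
    Nat.card (normalSet G p a b) = 2 * Nat.card (Quotient (congruenceSetoid G p)) :=
  ComplexRigidity.card_normalSet hb fun _ hn ↦ hG.not_collinear hp hV hab hn

theorem IsAlgRigid.isRealisationNumber [Finite V] (hG : IsAlgRigid G) (hp : IsGeneric p) :
    IsRealisationNumber G (Nat.card (Quotient (congruenceSetoid G p))) := by
  intro p' hp'
  have := hG.finite_quotient hp
  rw [numClasses_eq_of_isGeneric G hp' hp, numClasses, ENat.card_eq_coe_natCard]

/-- The realisations in standard position with a prescribed squared distance of the base points
correspond for any two distances which are transcendental over the squared edge lengths. -/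
theorem nonempty_equiv_normalSet_of_notMem [Finite V] {δ ε : ℂ}
    (hδ : δ ∉ algField (lengthSet G p)) (hε : ε ∉ algField (lengthSet G p)) :
    Nonempty ({n : normalSet G p a b // n.1.2 b = δ} ≃ {n : normalSet G p a b // n.1.2 b = ε}) := by
  let R := Algebra.adjoin ℚ (lengthSet G p)
  -- Countability of `R` allows the conjugation theorem for the one-element families `δ` and `ε`
  -- over `R`; the automorphism then fixes all edge lengths.
  have : Countable R := by
    rw [← Cardinal.mk_le_aleph0_iff]
    refine (Algebra.cardinalMk_adjoin_le ℚ (lengthSet G p)).trans ?_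
    have := (finite_lengthSet G p).countable.le_aleph0
    simp [this]
  have tr {x : ℂ} (hx : x ∉ algField (lengthSet G p)) :
      AlgebraicIndependent R fun _ : Unit ↦ x :=
    algebraicIndependent_unique_type_iff.2 fun h ↦ hx (mem_closure_algMatroid.2 h)
  obtain ⟨σ, hσ⟩ := exists_algEquiv_of_algebraicIndependent aleph0_lt_mk_complex (tr hδ) (tr hε)
  have hσ : σ δ = ε := hσ ()
  have hfix {u v : V} (h : G.Adj u v) : σ (sqLen (p u - p v)) = sqLen (p u - p v) :=
    σ.commutes ⟨_, Algebra.subset_adjoin ⟨u, v, h, rfl⟩⟩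
  let e : (V → ℂ) × (V → ℂ) ≃ (V → ℂ) × (V → ℂ) :=
    (Equiv.piCongrRight fun _ ↦ σ.toEquiv).prodCongr (Equiv.piCongrRight fun _ ↦ σ.toEquiv)
  have he1 (n v) : (e n).1 v = σ (n.1 v) := rfl
  have he2 (n v) : (e n).2 v = σ (n.2 v) := rfl
  have hmem (n) : n ∈ normalSet G p a b ↔ e n ∈ normalSet G p a b := by
    simp only [normalSet, Set.mem_ofPred_eq, he1, he2, EmbeddingLike.map_eq_zero_iff,
      EmbeddingLike.map_eq_one_iff]
    refine and_congr_right fun _ ↦ and_congr_right fun _ ↦ and_congr_right fun _ ↦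
      forall₃_congr fun u v h ↦ ?_
    rw [← map_sub, ← map_sub, ← map_mul]
    conv_rhs => rw [← hfix h]
    exact σ.injective.eq_iff.symm
  refine ⟨(Equiv.subtypeEquiv e hmem).subtypeEquiv fun n ↦ ?_⟩
  change _ ↔ σ (n.1.2 b) = ε
  rw [← hσ, σ.injective.eq_iff]

theorem mem_normalSet_sup_edge (hab : a ≠ b) {n : (V → ℂ) × (V → ℂ)} :
    n ∈ normalSet (G ⊔ SimpleGraph.edge a b) p a b ↔
      n ∈ normalSet G p a b ∧ n.2 b = sqLen (p a - p b) := by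
  constructor
  · rintro ⟨h1, h2, h3, h⟩
    refine ⟨⟨h1, h2, h3, fun u v e ↦ h u v (Or.inl e)⟩, ?_⟩
    rw [← h a b (Or.inr (by simp [SimpleGraph.edge_adj, hab])), h1, h2, h3]
    ring
  · rintro ⟨⟨h1, h2, h3, h⟩, hb⟩
    refine ⟨h1, h2, h3, ?_⟩
    rintro u v (e | e)
    · exact h u v e
    · rcases ((SimpleGraph.edge_adj _ _ _ _).1 e).1 with ⟨rfl, rfl⟩ | ⟨rfl, rfl⟩
      · rw [h1, h2, h3, hb]; ring
      · rw [h1, h2, h3, hb]; simp only [sqLen, Pi.sub_apply]; ring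

/-- Adding the edge joining the base points prescribes their squared distance. -/
noncomputable def normalSetSupEdgeEquiv (hab : a ≠ b) :
    normalSet (G ⊔ SimpleGraph.edge a b) p a b ≃
      {n : normalSet G p a b // n.1.2 b = sqLen (p a - p b)} :=
  (Equiv.subtypeEquivRight fun _ ↦ mem_normalSet_sup_edge hab).trans
    (Equiv.subtypeSubtypeEquivSubtypeInter (· ∈ normalSet G p a b)
      fun n ↦ n.2 b = sqLen (p a - p b)).symm

end NormalForm

/-! ### Gluing along the separating pair -/

section Gluing

variable {V : Type*} {G : SimpleGraph V} {G₁ G₂ : G.Subgraph}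

theorem exists_glue {α : Type*} {s t : Set V} (hst : s ∪ t = Set.univ) (f : s → α) (g : t → α)
    (h : ∀ v (hs : v ∈ s) (ht : v ∈ t), f ⟨v, hs⟩ = g ⟨v, ht⟩) :
    ∃ k : V → α, (∀ v : s, k v = f v) ∧ ∀ v : t, k v = g v := by
  classical
  have ht {v : V} (hv : v ∉ s) : v ∈ t :=
    (hst.ge (Set.mem_univ v)).resolve_left hv
  refine ⟨fun v ↦ if hv : v ∈ s then f ⟨v, hv⟩ else g ⟨v, ht hv⟩, fun v ↦ by simp, fun v ↦ ?_⟩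
  by_cases hv : (v : V) ∈ s
  · simp [hv, h v hv v.2]
  · simp [hv]

/-- A realisation of `G` in standard position is a pair of realisations of `G₁` and `G₂` in
standard position with the same squared distance of the base points. -/
theorem nonempty_equiv_normalSet_union (hsep : G₁ ⊔ G₂ = ⊤) {a b : V}
    (hv : G₁.verts ∩ G₂.verts = {a, b}) (p : Realisation V ℂ)
    (ha₁ : a ∈ G₁.verts) (hb₁ : b ∈ G₁.verts) (ha₂ : a ∈ G₂.verts) (hb₂ : b ∈ G₂.verts) :
    Nonempty (normalSet G p a b ≃
      Σ n : normalSet G₁.coe (fun v ↦ p v) ⟨a, ha₁⟩ ⟨b, hb₁⟩,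
        {m : normalSet G₂.coe (fun v ↦ p v) ⟨a, ha₂⟩ ⟨b, hb₂⟩ //
          m.1.2 ⟨b, hb₂⟩ = n.1.2 ⟨b, hb₁⟩}) := by
  have hun : G₁.verts ∪ G₂.verts = Set.univ := by
    rw [← SimpleGraph.Subgraph.verts_sup, hsep, SimpleGraph.Subgraph.verts_top]
  let f (n : normalSet G p a b) :
      Σ n : normalSet G₁.coe (fun v ↦ p v) ⟨a, ha₁⟩ ⟨b, hb₁⟩,
        {m : normalSet G₂.coe (fun v ↦ p v) ⟨a, ha₂⟩ ⟨b, hb₂⟩ //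
          m.1.2 ⟨b, hb₂⟩ = n.1.2 ⟨b, hb₁⟩} :=
    ⟨⟨(fun v ↦ n.1.1 v, fun v ↦ n.1.2 v), n.2.1, n.2.2.1, n.2.2.2.1,
        fun u v h ↦ n.2.2.2.2 u v h.adj_sub⟩,
      ⟨⟨(fun v ↦ n.1.1 v, fun v ↦ n.1.2 v), n.2.1, n.2.2.1, n.2.2.2.1,
        fun u v h ↦ n.2.2.2.2 u v h.adj_sub⟩, rfl⟩⟩
  refine ⟨Equiv.ofBijective f ⟨fun n m h ↦ ?_, ?_⟩⟩
  · have h1 := congrArg (fun x ↦ x.1.1) h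
    have h2 := congrArg (fun x ↦ x.2.1.1) h
    refine Subtype.ext (Prod.ext (funext fun v ↦ ?_) (funext fun v ↦ ?_)) <;>
    rcases hun.ge (Set.mem_univ v) with hv | hv
    · exact congrFun (congrArg Prod.fst h1) ⟨v, hv⟩
    · exact congrFun (congrArg Prod.fst h2) ⟨v, hv⟩
    · exact congrFun (congrArg Prod.snd h1) ⟨v, hv⟩
    · exact congrFun (congrArg Prod.snd h2) ⟨v, hv⟩
  · rintro ⟨⟨⟨z₁, w₁⟩, hn⟩, ⟨⟨⟨z₂, w₂⟩, hm⟩, hnm⟩⟩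
    have hint {v : V} (h₁ : v ∈ G₁.verts) (h₂ : v ∈ G₂.verts) : v = a ∨ v = b :=
      hv.le ⟨h₁, h₂⟩
    obtain ⟨z, hz₁, hz₂⟩ := exists_glue hun z₁ z₂ fun v h₁ h₂ ↦ by
      rcases hint h₁ h₂ with rfl | rfl
      · exact hn.1.trans hm.1.symm
      · exact hn.2.2.1.trans hm.2.2.1.symm
    obtain ⟨w, hw₁, hw₂⟩ := exists_glue hun w₁ w₂ fun v h₁ h₂ ↦ by
      rcases hint h₁ h₂ with rfl | rfl
      · exact hn.2.1.trans hm.2.1.symm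
      · exact hnm.symm
    obtain rfl : z₁ = fun v : G₁.verts ↦ z v := funext fun v ↦ (hz₁ v).symm
    obtain rfl : z₂ = fun v : G₂.verts ↦ z v := funext fun v ↦ (hz₂ v).symm
    obtain rfl : w₁ = fun v : G₁.verts ↦ w v := funext fun v ↦ (hw₁ v).symm
    obtain rfl : w₂ = fun v : G₂.verts ↦ w v := funext fun v ↦ (hw₂ v).symm
    refine ⟨⟨(z, w), hn.1, hn.2.1, hn.2.2.1, fun u v huv ↦ ?_⟩, rfl⟩
    have : (G₁ ⊔ G₂).Adj u v := by rw [hsep]; exact huv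
    rcases SimpleGraph.Subgraph.sup_adj.1 this with h | h
    · exact hn.2.2.2 ⟨u, h.fst_mem⟩ ⟨v, h.snd_mem⟩ h
    · exact hm.2.2.2 ⟨u, h.fst_mem⟩ ⟨v, h.snd_mem⟩ h

/-- The fibre over a realisation of `G₁` consists of the realisations of `G₂` with a prescribed
transcendental base distance. Conjugation identifies it with the fibre for the distance in `p`,
which is the normal set of `H₂`. -/
theorem card_normalSet_union [Finite V] (hsep : G₁ ⊔ G₂ = ⊤) {a b : V} (hab : a ≠ b)
    (hv : G₁.verts ∩ G₂.verts = {a, b}) {p : Realisation V ℂ}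
    (ha₁ : a ∈ G₁.verts) (hb₁ : b ∈ G₁.verts) (ha₂ : a ∈ G₂.verts) (hb₂ : b ∈ G₂.verts)
    (hδ : ∀ q, IsEquivalent G₁.coe (fun v ↦ p v) q →
      sqLen (q ⟨a, ha₁⟩ - q ⟨b, hb₁⟩) ∉ algField (lengthSet G₂.coe fun v ↦ p v)) :
    Nat.card (normalSet G p a b) =
      Nat.card (normalSet G₁.coe (fun v ↦ p v) ⟨a, ha₁⟩ ⟨b, hb₁⟩) *
        Nat.card (normalSet (G₂.coe ⊔ SimpleGraph.edge ⟨a, ha₂⟩ ⟨b, hb₂⟩) (fun v ↦ p v)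
          ⟨a, ha₂⟩ ⟨b, hb₂⟩) := by
  obtain ⟨f⟩ := nonempty_equiv_normalSet_union hsep hv p ha₁ hb₁ ha₂ hb₂
  have hne : (⟨a, ha₂⟩ : G₂.verts) ≠ ⟨b, hb₂⟩ := fun h ↦ hab (congrArg Subtype.val h)
  have g (n : normalSet G₁.coe (fun v ↦ p v) ⟨a, ha₁⟩ ⟨b, hb₁⟩) :
      Nonempty ({m : normalSet G₂.coe (fun v ↦ p v) ⟨a, ha₂⟩ ⟨b, hb₂⟩ //
          m.1.2 ⟨b, hb₂⟩ = n.1.2 ⟨b, hb₁⟩} ≃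
        normalSet (G₂.coe ⊔ SimpleGraph.edge ⟨a, ha₂⟩ ⟨b, hb₂⟩) (fun v ↦ p v)
          ⟨a, ha₂⟩ ⟨b, hb₂⟩) := by
    have hn := hδ _ (isEquivalent_ofNull n.2)
    rw [sqLen_ofNull_base n.2] at hn
    obtain ⟨g⟩ := nonempty_equiv_normalSet_of_notMem (a := (⟨a, ha₂⟩ : G₂.verts))
      (b := ⟨b, hb₂⟩) hn (hδ _ fun _ _ _ ↦ rfl)
    exact ⟨g.trans (normalSetSupEdgeEquiv hne).symm⟩
  rw [Nat.card_congr f, ← Nat.card_prod]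
  exact Nat.card_congr ((Equiv.sigmaCongrRight fun n ↦ (g n).some).trans
    (Equiv.sigmaEquivProd _ _))

end Gluing

end ComplexRigidity

theorem mainTheorem9 {V : Type*} [Finite V] (G : SimpleGraph V) (hG : ComplexRigidity.IsRigid G)
    (G₁ G₂ : G.Subgraph) (hsep : ComplexRigidity.IsSeparation 2 G₁ G₂)
    (v₁ v₂ : V) (hv : G₁.verts ∩ G₂.verts = {v₁, v₂})
    (hG₂ : ¬ ComplexRigidity.IsRigid G₂.coe)
    (H₂ : SimpleGraph G₂.verts)
    (hH₂ : H₂ = G₂.coe ⊔ SimpleGraph.edge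
      ⟨v₁, (hv.ge (Set.mem_insert v₁ {v₂})).2⟩
      ⟨v₂, (hv.ge (Set.mem_insert_of_mem v₁ (Set.mem_singleton v₂))).2⟩) :
    ComplexRigidity.IsRigid G₁.coe ∧ ComplexRigidity.IsRigid H₂ ∧
      ∃ c c₁ c₂ : ℕ,
        ComplexRigidity.IsRealisationNumber G c ∧
        ComplexRigidity.IsRealisationNumber G₁.coe c₁ ∧
        ComplexRigidity.IsRealisationNumber H₂ c₂ ∧
        c = 2 * c₁ * c₂ := by
  open ComplexRigidity in
  subst hH₂
  obtain ⟨ha₁, ha₂⟩ := hv.ge (Set.mem_insert v₁ {v₂})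
  obtain ⟨hb₁, hb₂⟩ := hv.ge (Set.mem_insert_of_mem v₁ (Set.mem_singleton v₂))
  have hne : v₁ ≠ v₂ := by
    rintro rfl
    have h := hsep.card_inter
    simp [hv] at h
  have hne₁ : (⟨v₁, ha₁⟩ : G₁.verts) ≠ ⟨v₂, hb₁⟩ := fun h ↦ hne (congrArg Subtype.val h)
  have hne₂ : (⟨v₁, ha₂⟩ : G₂.verts) ≠ ⟨v₂, hb₂⟩ := fun h ↦ hne (congrArg Subtype.val h)
  rw [isRigid_iff_isAlgRigid] at hG hG₂
  obtain ⟨p', hp'⟩ := exists_isGeneric_real V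
  obtain ⟨p, hp⟩ : ∃ p : Realisation V ℂ, IsGeneric p := ⟨_, hp'.ofReal⟩
  have hp₁ : IsGeneric fun v : G₁.verts ↦ p v := hp.comp_injective Subtype.val_injective
  have hp₂ : IsGeneric fun v : G₂.verts ↦ p v := hp.comp_injective Subtype.val_injective
  have hG₁ : IsAlgRigid G₁.coe := hsep.isAlgRigid_left hp hG hG₂ hne₁ hne₂
  have hH₂ : IsAlgRigid (G₂.coe ⊔ SimpleGraph.edge ⟨v₁, ha₂⟩ ⟨v₂, hb₂⟩) :=
    hsep.isAlgRigid_right hp hG hne₁ hne₂ rfl rfl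
  have hcard := hsep.card_add_card
  have c₁ := hsep.card_left
  have c₂ := hsep.card_right
  rw [← Nat.card_coe_set_eq] at c₁ c₂
  have hδ {q : Realisation G₁.verts ℂ} (hq : IsEquivalent G₁.coe (fun v ↦ p v) q) :=
    hsep.notMem_closure hp hG hG₂ hne₁ hne₂ hq
  -- Zero is algebraic, so the transcendental base distance is nonzero and normalisation loses no
  -- realisation.
  have hδ0 {q : Realisation G₁.verts ℂ} (hq : IsEquivalent G₁.coe (fun v ↦ p v) q) :
      sqLen (q ⟨v₁, ha₁⟩ - q ⟨v₂, hb₁⟩) ≠ 0 := fun h ↦ hδ hq (h ▸ zero_mem _)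
  have e := hG.card_normalSet hp (by omega) hne fun q hq ↦
    hδ0 (q := fun v ↦ q v) fun u v h ↦ hq u v h.adj_sub
  have e₁ := hG₁.card_normalSet hp₁ c₁ hne₁ fun q hq ↦ hδ0 hq
  have e₂ := hH₂.card_normalSet hp₂ c₂ hne₂ fun q hq ↦ by
    rw [← hq _ _ (Or.inr (by simp [SimpleGraph.edge_adj, hne]))]
    exact hp.sqLen_ne_zero hne
  have hprod := card_normalSet_union hsep.union_eq hne hv ha₁ hb₁ ha₂ hb₂ fun _ hq ↦ hδ hq
  refine ⟨hG₁.isRigid, hH₂.isRigid, _, _, _, hG.isRealisationNumber hp,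
    hG₁.isRealisationNumber hp₁, hH₂.isRealisationNumber hp₂, ?_⟩
  rw [e, e₁, e₂] at hprod
  -- Three factors `2`, one per normal set, appear in `2c = (2c₁)(2c₂)`; one cancels.
  refine Nat.eq_of_mul_eq_mul_left two_pos (hprod.trans ?_)
  ring
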